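/- Let $X\subset\mathbb{R}^n$ be compact and convex with nonempty interior, $U\subset\mathbb{R}^m$, $f:X\times U\to\mathbb{R}^n$, $\ell:X\times U\to\mathbb{R}$, $\phi:X\to\mathbb{R}\cup\{-\infty\}$, $T>0$. For $0\le t\le T$ and $x\in X$ let $v^t(x)$ be the supremum of $\int_0^t\ell(\mathbf{x}(s),\mathbf{u}(s))\,ds+\phi(\mathbf{x}(t))$ over all measurable $\mathbf{u}:[0,t]\to U$ and absolutely continuous $\mathbf{x}:[0,t]\to X$ with $\mathbf{x}(0)=x$ and $\dot{\mathbf{x}}(s)=f(\mathbf{x}(s),\mathbf{u}(s))$ for a.e. $s$ (and with integrable running reward). Let $H(x,p)=\sup_{u\in U}\big(\ell(x,u)+p\cdot f(x,u)\big)$. Assume that there are positive constants with (H1) $\|f(x,u)-f(y,u)\|_2\le L_f\|x-y\|_2$ and $\|f(x,u)\|_2\le M_f$ for all $x,y\in X$, $u\in U$; (H2) $|\ell(x,u)-\ell(y,u)|\le L_\ell\|x-y\|_2$ and $|\ell(x,u)|\le M_\ell$ for all $x,y\in X$, $u\in U$. Assume that constant controls are feasible: for all $x\in X$ and $u\in U$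 there is a trajectory on $[0,T]$ with control constantly equal to $u$ that starts at $x$ and stays in $X$. Let $c,L>0$ and assume that, for every $t\in[0,T]$, $v^t$ is real-valued on $X$, $c$-semiconvex (that is, $v^t+\frac c2\|\cdot\|_2^2$ is convex) and $L$-Lipschitz for $\|\cdot\|_2$. Let $a\ge L$ and $R\ge 0$. Let $\mathcal{T}\subset\mathbb{R}^n$ and $\hat{\mathcal{T}}\subset X+B_2(0,R)$ be finite and nonempty (closed ball; for $R=L/c$ the latter is a grid in $\hat X:=X+B_2(0,L/c)$), with points $\hat y_1,\dots,\hat y_q$ and $\hat x_1,\dots,\hat x_p$, respectively. Put $z_j(x)=-a\|x-\hat y_j\|_1$, $w_i(x)=-\frac c2\|x-\hat x_i\|_2^2$, $\langle z,w\rangle=\sup_{x\in X}(z(x)+w(x))$, and $\Delta x=\max(\rho_X(\mathcal{T}),\rho_{\hat X}(\hat{\mathcal{T}}))$, where $\rho_Y(P)=\sup_{p\in P}\sup_{x\in V(p)\cap Y}\|x-p\|_2$ and $V(p)=\{x\in\mathbb{R}^n:\|x-p\|_2\le\|x-q\|_2\ \forall q\in P\}$. Let $\delta=T/N$ with an integer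 $N\ge1$. For a $q\times p$ matrix $K$ define the max-plus finite element approximation by $$\lambda^0_i=\inf_{x\in X}\big(\phi(x)-w_i(x)\big),\qquad \lambda^{t+\delta}_i=\min_{1\le j\le q}\Big(-\langle z_j,w_i\rangle+\max_{1\le k\le p}\big(K_{jk}+\lambda^t_k\big)\Big),\qquad v_h^t(x)=\max_{1\le i\le p}\big(\lambda^t_i+w_i(x)\big)$$ for $t=0,\delta,2\delta,\dots$ (up to $T$). Consider the matrices $$(K_{H,h})_{ji}=\sup_{x\in X}\big(z_j(x)+w_i(x)+\delta H(x,\nabla w_i(x))\big),\qquad (\tilde K_{H,h})_{ji}=\langle z_j,w_i\rangle+\delta\sup_{x\in\arg\max_X(z_j+w_i)}H(x,\nabla w_i(x)).$$ Then there are constants $C_1,C_2>0$, depending only on $n$, $T$, $c$, $L$, $a$, $R$, $L_f$, $M_f$, $L_\ell$, $M_\ell$ and an upper bound on $\operatorname{diam}X$ (in particular not on $\delta$, $\mathcal{T}$, $\hat{\mathcal{T}}$), such that, with $K=K_{H,h}$, $$\sup_{x\in X}|v_h^T(x)-v^T(x)|\le C_1\Big(\delta+\frac{\Delta x}{\delta}\Big),$$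 and, with $K=\tilde K_{H,h}$, $$\sup_{x\in X}|v_h^T(x)-v^T(x)|\le C_2\Big(\sqrt\delta+\frac{\Delta x}{\delta}\Big).$$ -/

import Mathlib

open MeasureTheory
open scoped ENNReal Pointwise

noncomputable section

namespace MFEM

/-- `ℝⁿ` with the Euclidean norm. -/
abbrev E (n : ℕ) : Type := EuclideanSpace ℝ (Fin n)

/-- The data of a deterministic optimal control problem: state space `X ⊆ ℝⁿ`, control values
`U ⊆ ℝᵐ`, dynamics `f`, Lagrangian `ℓ` and terminal reward `φ`. Only the values of `f` and `ℓ`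
on `X × U` and those of `φ` on `X` are used below. -/
structure ControlProblem (n m : ℕ) where
  X : Set (E n)
  U : Set (E m)
  f : E n → E m → E n
  ℓ : E n → E m → ℝ
  φ : E n → EReal

variable {n m : ℕ}

/-! ### The control problem and its value function -/

/-- `(x, u)` is a trajectory on `[0, t]`: `u` is measurable with values in `U`, `x` is absolutely
continuous with values in `X`, and `x' = f (x, u)` almost everywhere on `[0, t]`. -/
structure IsTrajectory (P : ControlProblem n m) (t : ℝ) (x : ℝ → E n) (u : ℝ → E m) : Prop where
  measurable_control : Measurable u
  control_mem : ∀ s ∈ Set.Icc 0 t, u s ∈ P.U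
  absolutelyContinuous : AbsolutelyContinuousOnInterval x 0 t
  state_mem : ∀ s ∈ Set.Icc 0 t, x s ∈ P.X
  hasDerivAt : ∀ᵐ s ∂(volume.restrict (Set.Icc 0 t)), HasDerivAt x (P.f (x s) (u s)) s

/-- A trajectory starting at `x₀` whose running reward is integrable. The last condition is
automatic when `ℓ` is bounded and, say, continuous or Borel measurable on `X × U`. -/
def IsAdmissible (P : ControlProblem n m) (t : ℝ) (x₀ : E n) (x : ℝ → E n) (u : ℝ → E m) :
    Prop :=
  IsTrajectory P t x u ∧ x 0 = x₀ ∧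
    IntervalIntegrable (fun s => P.ℓ (x s) (u s)) volume 0 t

/-- The value function `vᵗ(x₀) = sup ∫₀ᵗ ℓ(x(s), u(s)) ds + φ(x(t))`. -/
def value (P : ControlProblem n m) (t : ℝ) (x₀ : E n) : EReal :=
  ⨆ (x : ℝ → E n) (u : ℝ → E m) (_ : IsAdmissible P t x₀ x u),
    ((∫ s in (0 : ℝ)..t, P.ℓ (x s) (u s) : ℝ) : EReal) + P.φ (x t)

/-- The Hamiltonian `H(x, p) = sup_{u ∈ U} ℓ(x, u) + p · f(x, u)`. -/
def hamiltonian (P : ControlProblem n m) (x p : E n) : EReal :=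
  ⨆ u ∈ P.U, ((P.ℓ x u + inner ℝ p (P.f x u) : ℝ) : EReal)

/-- Assumption (H1): `f` is bounded by `Mf` and `Lf`-Lipschitz in `x`, uniformly in `u`. -/
def H1 (P : ControlProblem n m) (Lf Mf : ℝ) : Prop :=
  (∀ x ∈ P.X, ∀ y ∈ P.X, ∀ u ∈ P.U, ‖P.f x u - P.f y u‖ ≤ Lf * ‖x - y‖) ∧
    ∀ x ∈ P.X, ∀ u ∈ P.U, ‖P.f x u‖ ≤ Mf

/-- Assumption (H2): `ℓ` is bounded by `Mℓ` and `Lℓ`-Lipschitz in `x`, uniformly in `u`. -/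
def H2 (P : ControlProblem n m) (Lℓ Mℓ : ℝ) : Prop :=
  (∀ x ∈ P.X, ∀ y ∈ P.X, ∀ u ∈ P.U, |P.ℓ x u - P.ℓ y u| ≤ Lℓ * ‖x - y‖) ∧
    ∀ x ∈ P.X, ∀ u ∈ P.U, |P.ℓ x u| ≤ Mℓ

/-- Constant controls are feasible: from every state, the trajectory driven by a constant control
exists on `[0, T]` and stays in `X`. -/
def ConstantControlsFeasible (P : ControlProblem n m) (T : ℝ) : Prop :=
  ∀ x₀ ∈ P.X, ∀ u₀ ∈ P.U, ∃ x : ℝ → E n, x 0 = x₀ ∧ IsTrajectory P T x (fun _ => u₀)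

/-- `v` is finite on `X`, `c`-semiconvex on `X`, and `L`-Lipschitz on `X` for the Euclidean
norm. -/
def SemiconvexLipschitzOn (X : Set (E n)) (c L : ℝ) (v : E n → EReal) : Prop :=
  ∃ g : E n → ℝ, (∀ x ∈ X, v x = (g x : EReal)) ∧
    ConvexOn ℝ X (fun x => g x + c / 2 * ‖x‖ ^ 2) ∧
    ∀ x ∈ X, ∀ y ∈ X, |g x - g y| ≤ L * ‖x - y‖

/-! ### Max-plus linear algebra over `EReal`

Addition of `EReal` satisfies `⊥ + ⊤ = ⊥`, which is the convention of the complete max-plus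
semiring. -/

/-- The max-plus scalar product `⟨u, v⟩ = sup_x u(x) + v(x)`. -/
def scalarProd {I : Type*} (u v : I → EReal) : EReal := ⨆ x, u x + v x

/-- The max-plus kernel operator `(A v)(j) = sup_i A(j, i) + v(i)`. -/
def mulVec {I J : Type*} (A : J → I → EReal) (v : I → EReal) : J → EReal :=
  fun j => ⨆ i, A j i + v i

/-- The scalar residual `a \ b = max {r | a + r ≤ b}`. -/
def residual (a b : EReal) : EReal := sSup {r : EReal | a + r ≤ b}

/-- The residuated operator `(A \ v)(i) = inf_j A(j, i) \ v(j)` of a kernel operator. -/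
def residualVec {I J : Type*} (A : J → I → EReal) (v : J → EReal) : I → EReal :=
  fun i => ⨅ j, residual (A j i) (v j)

/-- The sup-norm, with values in `[0, ∞]`; it is `∞` as soon as some value is infinite. -/
def supNorm {I : Type*} (u : I → EReal) : ℝ≥0∞ := ⨆ i, (u i).abs

/-! ### Finite elements and matrices -/

/-- The quadratic finite element of Hessian `c` centred at `xh`. -/
def quadElement (c : ℝ) (xh x : E n) : ℝ := -(c / 2) * ‖x - xh‖ ^ 2

/-- The Lipschitz finite element of constant `a` centred at `yh` (`ℓ¹`-norm). -/
def lipElement (a : ℝ) (yh x : E n) : ℝ := -a * ∑ i, |x i - yh i|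

/-- The function `x ↦ H(x, ∇w(x))`. -/
def hamGrad (P : ControlProblem n m) (w : E n → ℝ) (x : E n) : EReal :=
  hamiltonian P x (gradient w x)

/-- The approximation `[S^δ w]_H (x) = w(x) + δ H(x, ∇w(x))` of `S^δ w`. -/
def approxStep (P : ControlProblem n m) (δ : ℝ) (w : E n → ℝ) (x : E n) : EReal :=
  (w x : EReal) + (δ : EReal) * hamGrad P w x

/-- The max-plus scalar product over `X` of two real functions. -/
def scalarProdOn (X : Set (E n)) (z w : E n → ℝ) : EReal :=
  scalarProd (fun x : X => (z x : EReal)) (fun x : X => (w x : EReal))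

/-- The maximizers of `z + w` over `X`. -/
def argmaxOn (X : Set (E n)) (z w : E n → ℝ) : Set (E n) :=
  {x | x ∈ X ∧ (z x : EReal) + (w x : EReal) = scalarProdOn X z w}

section Method

/- `S` is the set of centres of the test functions (of constant `a`), `Sh` that of the finite
elements (of Hessian `c`). -/

variable (P : ControlProblem n m) (c a δ : ℝ) (S Sh : Finset (E n))

/-- The matrix `W_h = col (w_i)`, with rows indexed by `X`. -/
def matW : P.X → Sh → EReal := fun x i => (quadElement c (i : E n) (x : E n) : EReal)

/-- The mass matrix `(M_h)_{ji} = ⟨z_j, w_i⟩`. -/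
def matM : S → Sh → EReal := fun j i =>
  scalarProdOn P.X (lipElement a (j : E n)) (quadElement c (i : E n))

/-- The stiffness matrix `(K_{H,h})_{ji} = sup_{x ∈ X} z_j(x) + w_i(x) + δ H(x, ∇w_i(x))`. -/
def matKH : S → Sh → EReal := fun j i =>
  scalarProd (fun x : P.X => (lipElement a (j : E n) x : EReal))
    (fun x : P.X => approxStep P δ (quadElement c (i : E n)) x)

/-- The cheaper matrix
`(K̃_{H,h})_{ji} = ⟨z_j, w_i⟩ + δ sup_{x ∈ argmax (z_j + w_i)} H(x, ∇w_i(x))`. -/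
def matKHt : S → Sh → EReal := fun j i =>
  scalarProdOn P.X (lipElement a (j : E n)) (quadElement c (i : E n)) +
    (δ : EReal) *
      ⨆ x ∈ argmaxOn P.X (lipElement a (j : E n)) (quadElement c (i : E n)),
        hamGrad P (quadElement c (i : E n)) x

/-- The coefficients `λ^{kδ}` of the max-plus finite element method with stiffness matrix `K`:
`λ⁰ = W_h \ φ` and `λ^{t+δ} = M_h \ (K λᵗ)`. -/
def coeff (K : S → Sh → EReal) : ℕ → Sh → EReal
  | 0 => residualVec (matW P c Sh) (fun x : P.X => P.φ x)
  | k + 1 => residualVec (matM P c a S Sh) (mulVec K (coeff K k))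

/-- The approximation `v_h^{kδ} = W_h λ^{kδ}` of the value function at time `kδ`. -/
def approxValue (K : S → Sh → EReal) (k : ℕ) : P.X → EReal :=
  mulVec (matW P c Sh) (coeff P c a S Sh K k)

end Method

/-! ### Voronoi cells -/

/-- The Voronoi cell of `p` with respect to the finite set `S`. -/
def voronoiCell (S : Finset (E n)) (p : E n) : Set (E n) :=
  {x | ∀ q ∈ S, ‖x - p‖ ≤ ‖x - q‖}

/-- The maximal radius `ρ_X(S)` of the Voronoi cells of the points of `S`, restricted to `X`. -/
def voronoiRadius (X : Set (E n)) (S : Finset (E n)) : ℝ :=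
  sSup {r | ∃ p ∈ S, ∃ x ∈ voronoiCell S p ∩ X, r = ‖x - p‖}

end MFEM

end

/-! The scheme is a max-plus Galerkin recursion, and its error is (number of steps) × (projection
errors + consistency error of one step).

Consistency: a quadratic element has an exact second-order expansion, and trajectories are
`Mf`-Lipschitz. Propagating `w_i` over a time `δ` therefore differs from `w_i + δ H(x, ∇w_i)` by
`O(δ²)`. The dynamic programming inequalities turn this into `value_add_le_of_forall_exists` and
`le_value_add_of_forall`; constant controls suffice for the second.

Projection: a `c`-semiconvex `L`-Lipschitz function has at each point a quadratic minorant touching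
it there, with centre within `L / c`. Moving that centre to the nearest grid point costs `O(Δx)`
(`exists_quadElement_sub_le`). Dually, since `a ≥ L`, a cone `z_j` centred near `x` tests the
function at `x` up to `O(Δx)` (`exists_lipElement_le`).

`realCoeff_error` accumulates these over `N = T / δ` steps: `N (O(δ²) + O(Δx))` is of order `δ + Δx
/ δ`.

For `K̃`, `z_j + w_i` is strongly concave, so it drops quadratically away from its maximizer, while
`δ H(x, ∇w_i(x))` varies at most linearly with slope `O(δ)`. Hence `K̃` agrees with `K_{H,h}` up to
`O(δ²)` (`matKHt_eq_coe`), and the same argument bounds its error by a multiple of `δ + Δx / δ`. The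
stated `√δ` bound follows since `δ ≤ T`. -/

namespace MFEM

variable {n m : ℕ}

/-! ### Trajectories: estimates over a short time, shifting and gluing -/

namespace IsTrajectory

variable {P : ControlProblem n m} {t : ℝ} {x : ℝ → E n} {u : ℝ → E m}

/-- Trajectories are integrated through scalar projections, to which the fundamental theorem of
calculus for absolutely continuous real functions applies. -/
theorem absolutelyContinuous_inner (h : IsTrajectory P t x u) (p : E n) :
    AbsolutelyContinuousOnInterval (fun s => inner ℝ p (x s)) 0 t := by
  have hx := h.absolutelyContinuous
  rw [absolutelyContinuousOnInterval_iff] at hx ⊢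
  intro ε hε
  obtain ⟨d, hd, H⟩ := hx (ε / (‖p‖ + 1)) (by positivity)
  refine ⟨d, hd, fun I hI hlt => ?_⟩
  have h1 := H I hI hlt
  rw [lt_div_iff₀ (by positivity), Finset.sum_mul] at h1
  refine lt_of_le_of_lt (Finset.sum_le_sum fun i _ => ?_) h1
  rw [Real.dist_eq, ← inner_sub_right, dist_eq_norm]
  have := abs_real_inner_le_norm p (x (I.2 i).1 - x (I.2 i).2)
  nlinarith [norm_nonneg (x (I.2 i).1 - x (I.2 i).2)]

theorem ae_deriv_inner (h : IsTrajectory P t x u) (p : E n) :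
    ∀ᵐ s, s ∈ Set.Icc 0 t →
      deriv (fun s => inner ℝ p (x s)) s = inner ℝ p (P.f (x s) (u s)) := by
  have h1 := (ae_restrict_iff' measurableSet_Icc).1 h.hasDerivAt
  filter_upwards [h1] with s hs hst
  exact ((innerSL ℝ p).hasFDerivAt.comp_hasDerivAt s (hs hst)).deriv

theorem integral_deriv_inner (h : IsTrajectory P t x u) (p : E n) {a b : ℝ} (ha : 0 ≤ a)
    (hab : a ≤ b) (hb : b ≤ t) :
    IntervalIntegrable (deriv fun s => inner ℝ p (x s)) volume a b ∧
      ∫ s in a..b, deriv (fun s => inner ℝ p (x s)) s = inner ℝ p (x b - x a) := by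
  have hac := (h.absolutelyContinuous_inner p).mono (c := a) (d := b) (by
    rw [Set.uIcc_of_le hab, Set.uIcc_of_le (by linarith)]
    exact Set.Icc_subset_Icc ha hb)
  exact ⟨hac.intervalIntegrable_deriv, by rw [hac.integral_deriv_eq_sub, inner_sub_right]⟩

/-- Projecting on the displacement `d = x b - x a` itself gives `‖d‖² = ∫ ⟨d, f⟩ ≤ ‖d‖ Mf (b - a)`.
-/
theorem norm_sub_le (h : IsTrajectory P t x u) {Lf Mf : ℝ} (h1 : H1 P Lf Mf) {a b : ℝ}
    (ha : 0 ≤ a) (hab : a ≤ b) (hb : b ≤ t) : ‖x b - x a‖ ≤ Mf * (b - a) := by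
  obtain ⟨hi, he⟩ := h.integral_deriv_inner (x b - x a) ha hab hb
  rw [real_inner_self_eq_norm_sq] at he
  have hle : ∫ s in a..b, deriv (fun s => inner ℝ (x b - x a) (x s)) s ≤
      ∫ _ in a..b, ‖x b - x a‖ * Mf := by
    refine intervalIntegral.integral_mono_ae_restrict hab hi (by simp) ?_
    rw [Filter.EventuallyLE, ae_restrict_iff' measurableSet_Icc]
    filter_upwards [h.ae_deriv_inner (x b - x a)] with s hs hsab
    have hst : s ∈ Set.Icc 0 t := ⟨ha.trans hsab.1, hsab.2.trans hb⟩
    rw [hs hst]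
    exact (real_inner_le_norm _ _).trans (mul_le_mul_of_nonneg_left
      (h1.2 _ (h.state_mem s hst) _ (h.control_mem s hst)) (norm_nonneg _))
  rw [he, intervalIntegral.integral_const, smul_eq_mul] at hle
  rcases (norm_nonneg (x b - x a)).eq_or_lt with h0 | h0
  · rw [← h0]
    have hM : 0 ≤ Mf := (norm_nonneg _).trans (h1.2 _ (h.state_mem a ⟨ha, hab.trans hb⟩) _
      (h.control_mem a ⟨ha, hab.trans hb⟩))
    exact mul_nonneg hM (by linarith)
  · nlinarith

/-- The reward and the linearized displacement of a trajectory, as one integral. -/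
theorem integral_add_inner (h : IsTrajectory P t x u) (p : E n) {δ : ℝ} (hδ : 0 ≤ δ)
    (hδt : δ ≤ t) (hint : IntervalIntegrable (fun s => P.ℓ (x s) (u s)) volume 0 δ) :
    IntervalIntegrable (fun s => P.ℓ (x s) (u s) + deriv (fun s => inner ℝ p (x s)) s)
        volume 0 δ ∧
      (∫ s in (0 : ℝ)..δ, P.ℓ (x s) (u s)) + inner ℝ p (x δ - x 0) =
        ∫ s in (0 : ℝ)..δ, P.ℓ (x s) (u s) + deriv (fun s => inner ℝ p (x s)) s := by
  obtain ⟨hi, he⟩ := h.integral_deriv_inner p le_rfl hδ hδt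
  exact ⟨hint.add hi, by rw [intervalIntegral.integral_add hint hi, he]⟩

/-- Freezing the state at `x 0` in the integrand, with the control still varying, costs `(Lℓ + ‖p‖
Lf) Mf δ` pointwise; the frozen integrand is at most `H`. -/
theorem integral_add_inner_le (h : IsTrajectory P t x u) {Lf Mf Lℓ Mℓ : ℝ} (h1 : H1 P Lf Mf)
    (h2 : H2 P Lℓ Mℓ) (hLf : 0 ≤ Lf) (hLℓ : 0 ≤ Lℓ) (hMf : 0 ≤ Mf) (p : E n) {δ : ℝ} (hδ : 0 ≤ δ)
    (hδt : δ ≤ t) (hint : IntervalIntegrable (fun s => P.ℓ (x s) (u s)) volume 0 δ) {H : ℝ}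
    (hH : ∀ v ∈ P.U, P.ℓ (x 0) v + inner ℝ p (P.f (x 0) v) ≤ H) :
    (∫ s in (0 : ℝ)..δ, P.ℓ (x s) (u s)) + inner ℝ p (x δ - x 0) ≤
      δ * H + (Lℓ + ‖p‖ * Lf) * Mf * δ ^ 2 := by
  obtain ⟨hi, he⟩ := h.integral_add_inner p hδ hδt hint
  have hle : ∫ s in (0 : ℝ)..δ, P.ℓ (x s) (u s) + deriv (fun s => inner ℝ p (x s)) s ≤
      ∫ _ in (0 : ℝ)..δ, (H + (Lℓ + ‖p‖ * Lf) * Mf * δ) := by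
    refine intervalIntegral.integral_mono_ae_restrict hδ hi (by simp) ?_
    rw [Filter.EventuallyLE, ae_restrict_iff' measurableSet_Icc]
    filter_upwards [h.ae_deriv_inner p] with s hs hsδ
    have hst : s ∈ Set.Icc 0 t := ⟨hsδ.1, hsδ.2.trans hδt⟩
    have h0t : (0 : ℝ) ∈ Set.Icc 0 t := ⟨le_rfl, hδ.trans hδt⟩
    rw [hs hst]
    have hd : ‖x s - x 0‖ ≤ Mf * δ := (h.norm_sub_le h1 le_rfl hsδ.1 hst.2).trans
      (mul_le_mul_of_nonneg_left (by linarith [hsδ.2]) hMf)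
    have e1 := (abs_le.1 (h2.1 _ (h.state_mem s hst) _ (h.state_mem 0 h0t) _
      (h.control_mem s hst))).2
    have e2 := h1.1 _ (h.state_mem s hst) _ (h.state_mem 0 h0t) _ (h.control_mem s hst)
    have e3 : inner ℝ p (P.f (x s) (u s) - P.f (x 0) (u s)) ≤ ‖p‖ * (Lf * (Mf * δ)) :=
      (real_inner_le_norm _ _).trans (mul_le_mul_of_nonneg_left
        (e2.trans (mul_le_mul_of_nonneg_left hd hLf)) (norm_nonneg _))
    rw [inner_sub_right] at e3
    have e4 := mul_le_mul_of_nonneg_left hd hLℓ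
    nlinarith [hH _ (h.control_mem s hst)]
  rw [← he, intervalIntegral.integral_const, smul_eq_mul] at hle
  linarith

theorem le_integral_add_inner {v : E m} (h : IsTrajectory P t x fun _ => v) {Lf Mf Lℓ Mℓ : ℝ}
    (h1 : H1 P Lf Mf) (h2 : H2 P Lℓ Mℓ) (hLf : 0 ≤ Lf) (hLℓ : 0 ≤ Lℓ) (hMf : 0 ≤ Mf) (p : E n)
    {δ : ℝ} (hδ : 0 ≤ δ) (hδt : δ ≤ t)
    (hint : IntervalIntegrable (fun s => P.ℓ (x s) v) volume 0 δ) :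
    δ * (P.ℓ (x 0) v + inner ℝ p (P.f (x 0) v)) - (Lℓ + ‖p‖ * Lf) * Mf * δ ^ 2 ≤
      (∫ s in (0 : ℝ)..δ, P.ℓ (x s) v) + inner ℝ p (x δ - x 0) := by
  obtain ⟨hi, he⟩ := h.integral_add_inner p hδ hδt hint
  have hle : ∫ _ in (0 : ℝ)..δ,
        (P.ℓ (x 0) v + inner ℝ p (P.f (x 0) v) - (Lℓ + ‖p‖ * Lf) * Mf * δ) ≤
      ∫ s in (0 : ℝ)..δ, P.ℓ (x s) v + deriv (fun s => inner ℝ p (x s)) s := by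
    refine intervalIntegral.integral_mono_ae_restrict hδ (by simp) hi ?_
    rw [Filter.EventuallyLE, ae_restrict_iff' measurableSet_Icc]
    filter_upwards [h.ae_deriv_inner p] with s hs hsδ
    have hst : s ∈ Set.Icc 0 t := ⟨hsδ.1, hsδ.2.trans hδt⟩
    have h0t : (0 : ℝ) ∈ Set.Icc 0 t := ⟨le_rfl, hδ.trans hδt⟩
    rw [hs hst]
    have hd : ‖x s - x 0‖ ≤ Mf * δ := (h.norm_sub_le h1 le_rfl hsδ.1 hst.2).trans
      (mul_le_mul_of_nonneg_left (by linarith [hsδ.2]) hMf)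
    have e1 := (abs_le.1 (h2.1 _ (h.state_mem s hst) _ (h.state_mem 0 h0t) _
      (h.control_mem s hst))).1
    have e2 := h1.1 _ (h.state_mem s hst) _ (h.state_mem 0 h0t) _ (h.control_mem s hst)
    have e3 : -(‖p‖ * (Lf * (Mf * δ))) ≤ inner ℝ p (P.f (x s) v - P.f (x 0) v) :=
      (neg_le_neg (mul_le_mul_of_nonneg_left
        (e2.trans (mul_le_mul_of_nonneg_left hd hLf)) (norm_nonneg _))).trans
        (abs_le.1 (abs_real_inner_le_norm _ _)).1
    rw [inner_sub_right] at e3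
    have e4 := mul_le_mul_of_nonneg_left hd hLℓ
    nlinarith
  rw [← he, intervalIntegral.integral_const, smul_eq_mul] at hle
  linarith

theorem restrict (h : IsTrajectory P t x u) {δ : ℝ} (hδ : 0 ≤ δ) (hδt : δ ≤ t) :
    IsTrajectory P δ x u where
  measurable_control := h.measurable_control
  control_mem s hs := h.control_mem s ⟨hs.1, hs.2.trans hδt⟩
  absolutelyContinuous := h.absolutelyContinuous.mono (by
    rw [Set.uIcc_of_le hδ, Set.uIcc_of_le (by linarith)]
    exact Set.Icc_subset_Icc le_rfl hδt)
  state_mem s hs := h.state_mem s ⟨hs.1, hs.2.trans hδt⟩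
  hasDerivAt := ae_restrict_of_ae_restrict_of_subset (Set.Icc_subset_Icc le_rfl hδt) h.hasDerivAt

/-- Absolute continuity of a curve that is Lipschitz on `[0, t]`. -/
theorem absolutelyContinuous_of_lipschitz {y : ℝ → E n} {M : ℝ} (ht : 0 ≤ t) (hM : 0 ≤ M)
    (hy : ∀ a ∈ Set.Icc 0 t, ∀ b ∈ Set.Icc 0 t, a ≤ b → ‖y b - y a‖ ≤ M * (b - a)) :
    AbsolutelyContinuousOnInterval y 0 t := by
  refine LipschitzOnWith.absolutelyContinuousOnInterval (K := ⟨M, hM⟩) ?_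
  rw [Set.uIcc_of_le ht]
  refine LipschitzOnWith.of_dist_le_mul fun a ha b hb => ?_
  rw [dist_eq_norm, Real.dist_eq]
  change _ ≤ M * _
  rcases le_total a b with hab | hab
  · rw [norm_sub_rev, abs_of_nonpos (by linarith), neg_sub]
    exact hy a ha b hb hab
  · rw [abs_of_nonneg (by linarith)]
    exact hy b hb a ha hab

theorem shift {δ : ℝ} (h : IsTrajectory P (t + δ) x u) {Lf Mf : ℝ} (h1 : H1 P Lf Mf)
    (hMf : 0 ≤ Mf) (ht : 0 ≤ t) (hδ : 0 ≤ δ) :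
    IsTrajectory P t (fun s => x (s + δ)) (fun s => u (s + δ)) where
  measurable_control := h.measurable_control.comp (measurable_id.add_const δ)
  control_mem s hs := h.control_mem _ ⟨by linarith [hs.1], by linarith [hs.2]⟩
  absolutelyContinuous := absolutelyContinuous_of_lipschitz ht hMf fun a ha b hb hab =>
    (h.norm_sub_le h1 (by linarith [ha.1]) (by linarith) (by linarith [hb.2])).trans
      (by rw [add_sub_add_right_eq_sub])
  state_mem s hs := h.state_mem _ ⟨by linarith [hs.1], by linarith [hs.2]⟩
  hasDerivAt := by
    have h1 := (ae_restrict_iff' measurableSet_Icc).1 h.hasDerivAt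
    rw [ae_restrict_iff' measurableSet_Icc]
    have h2 := (measurePreserving_add_right volume δ).quasiMeasurePreserving.ae h1
    filter_upwards [h2] with s hs hst
    exact (hs ⟨by linarith [hst.1], by linarith [hst.2]⟩).comp_add_const s δ

/-- Both pieces are `Mf`-Lipschitz, hence so is the glued curve; differentiability may fail at the
junction, a null set. -/
theorem concat {δ : ℝ} {y : ℝ → E n} {v : ℝ → E m} (hy : IsTrajectory P δ y v)
    (h : IsTrajectory P t x u) (hxy : x 0 = y δ) {Lf Mf : ℝ} (h1 : H1 P Lf Mf) (hMf : 0 ≤ Mf)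
    (ht : 0 ≤ t) (hδ : 0 ≤ δ) :
    IsTrajectory P (t + δ) (fun s => if s ≤ δ then y s else x (s - δ))
      (fun s => if s ≤ δ then v s else u (s - δ)) where
  measurable_control := Measurable.ite measurableSet_Iic hy.measurable_control
    (h.measurable_control.comp (measurable_id.sub_const δ))
  control_mem s hs := by
    split_ifs with hsδ
    · exact hy.control_mem s ⟨hs.1, hsδ⟩
    · exact h.control_mem _ ⟨by linarith, by linarith [hs.2]⟩
  state_mem s hs := by
    split_ifs with hsδ
    · exact hy.state_mem s ⟨hs.1, hsδ⟩
    · exact h.state_mem _ ⟨by linarith, by linarith [hs.2]⟩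
  absolutelyContinuous := by
    refine absolutelyContinuous_of_lipschitz (by linarith) hMf fun a ha b hb hab => ?_
    split_ifs with hbδ haδ haδ
    · exact hy.norm_sub_le h1 ha.1 hab hbδ
    · linarith
    · have e1 := hy.norm_sub_le h1 ha.1 haδ le_rfl
      have e2 := h.norm_sub_le h1 (a := 0) (b := b - δ) le_rfl (by linarith) (by linarith [hb.2])
      have e3 : x (b - δ) - y a = (x (b - δ) - x 0) + (y δ - y a) := by rw [hxy]; abel
      rw [e3]
      exact (norm_add_le _ _).trans (by linarith)
    · exact (h.norm_sub_le h1 (by linarith) (by linarith) (by linarith [hb.2])).trans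
        (by rw [sub_sub_sub_cancel_right])
  hasDerivAt := by
    have hd1 := (ae_restrict_iff' measurableSet_Icc).1 hy.hasDerivAt
    have hd2 := (ae_restrict_iff' measurableSet_Icc).1 h.hasDerivAt
    have hd3 := (measurePreserving_sub_right volume δ).quasiMeasurePreserving.ae hd2
    have hd4 : ∀ᵐ s : ℝ, s ≠ δ := by simp [ae_iff, measure_singleton]
    rw [ae_restrict_iff' measurableSet_Icc]
    filter_upwards [hd1, hd3, hd4] with s h1 h3 hne hs
    rcases lt_or_gt_of_ne hne with hlt | hgt
    · rw [if_pos hlt.le, if_pos hlt.le]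
      refine (h1 ⟨hs.1, hlt.le⟩).congr_of_eventuallyEq ?_
      filter_upwards [eventually_lt_nhds hlt] with r hr
      rw [if_pos hr.le]
    · rw [if_neg (not_le.2 hgt), if_neg (not_le.2 hgt)]
      refine ((h3 ⟨by linarith, by linarith [hs.2]⟩).comp_sub_const s δ).congr_of_eventuallyEq ?_
      filter_upwards [eventually_gt_nhds hgt] with r hr
      rw [if_neg (not_le.2 hr)]

/-- With the control frozen the running reward is continuous in time, so no measurability of `ℓ` in
`u` is needed. -/
theorem intervalIntegrable_const_control {v : E m} (h : IsTrajectory P t x fun _ => v)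
    {Lℓ Mℓ : ℝ} (h2 : H2 P Lℓ Mℓ) (hLℓ : 0 ≤ Lℓ) (ht : 0 ≤ t) :
    IntervalIntegrable (fun s => P.ℓ (x s) v) volume 0 t := by
  have hv : v ∈ P.U := h.control_mem 0 ⟨le_rfl, ht⟩
  have hx := h.absolutelyContinuous.continuousOn
  have hl : LipschitzOnWith ⟨Lℓ, hLℓ⟩ (fun y => P.ℓ y v) P.X :=
    LipschitzOnWith.of_dist_le_mul fun y hy z hz => by
      rw [Real.dist_eq, dist_eq_norm]
      exact h2.1 y hy z hz v hv
  refine (hl.continuousOn.comp hx fun s hs => ?_).intervalIntegrable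
  rw [Set.uIcc_of_le ht] at hs
  exact h.state_mem s hs

end IsTrajectory

/-! ### Dynamic programming -/

theorem exists_admissible {P : ControlProblem n m} {t : ℝ} {x₀ : E n} (h : value P t x₀ ≠ ⊥) :
    ∃ x u, IsAdmissible P t x₀ x u := by
  by_contra! hne
  refine h (eq_bot_iff.2 ?_)
  exact iSup_le fun x => iSup_le fun u => iSup_le fun hxu => absurd hxu (hne x u)

theorem value_zero {P : ControlProblem n m} {x₀ : E n} (h : value P 0 x₀ ≠ ⊥) :
    value P 0 x₀ = P.φ x₀ := by
  obtain ⟨x, u, hxu⟩ := exists_admissible h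
  refine le_antisymm (iSup_le fun y => iSup_le fun v => iSup_le fun hyv => ?_) ?_
  · simp [hyv.2.1]
  · refine le_trans ?_ (le_iSup_of_le x (le_iSup_of_le u (le_iSup_of_le hxu le_rfl)))
    simp [hxu.2.1]

/-- The upper half of dynamic programming: the tail of an admissible pair after time `δ` competes in
`value P t (x δ)`. -/
theorem value_add_le {P : ControlProblem n m} {Lf Mf t δ : ℝ} (h1 : H1 P Lf Mf) (hMf : 0 ≤ Mf)
    (ht : 0 ≤ t) (hδ : 0 ≤ δ) {x₀ : E n} {B : EReal}
    (hB : ∀ x u, IsTrajectory P (t + δ) x u → x 0 = x₀ →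
      IntervalIntegrable (fun s => P.ℓ (x s) (u s)) volume 0 δ →
      ((∫ s in (0 : ℝ)..δ, P.ℓ (x s) (u s) : ℝ) : EReal) + value P t (x δ) ≤ B) :
    value P (t + δ) x₀ ≤ B := by
  refine iSup_le fun x => iSup_le fun u => iSup_le fun hxu => ?_
  obtain ⟨htr, hx0, hint⟩ := hxu
  have hi1 : IntervalIntegrable (fun s => P.ℓ (x s) (u s)) volume 0 δ :=
    hint.mono_set (by
      rw [Set.uIcc_of_le hδ, Set.uIcc_of_le (by linarith)]
      exact Set.Icc_subset_Icc le_rfl (by linarith))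
  have hi2 : IntervalIntegrable (fun s => P.ℓ (x s) (u s)) volume δ (t + δ) :=
    hint.mono_set (by
      rw [Set.uIcc_of_le (by linarith), Set.uIcc_of_le (by linarith)]
      exact Set.Icc_subset_Icc hδ le_rfl)
  have hadm : IsAdmissible P t (x δ) (fun s => x (s + δ)) (fun s => u (s + δ)) := by
    refine ⟨htr.shift h1 hMf ht hδ, by simp, ?_⟩
    have := hi2.comp_add_right δ
    simpa using this
  refine le_trans ?_ (hB x u htr hx0 hi1)
  have hval : ((∫ s in (0 : ℝ)..t, P.ℓ (x (s + δ)) (u (s + δ)) : ℝ) : EReal) + P.φ (x (t + δ)) ≤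
      value P t (x δ) :=
    le_iSup_of_le (fun s => x (s + δ)) (le_iSup_of_le (fun s => u (s + δ))
      (le_iSup_of_le hadm le_rfl))
  refine le_trans (le_of_eq ?_) (add_le_add le_rfl hval)
  rw [← add_assoc, ← EReal.coe_add,
    intervalIntegral.integral_comp_add_right (fun s => P.ℓ (x s) (u s)) δ, zero_add,
    intervalIntegral.integral_add_adjacent_intervals hi1 hi2]

theorem le_value_add {P : ControlProblem n m} {Lf Mf t δ : ℝ} (h1 : H1 P Lf Mf) (hMf : 0 ≤ Mf)
    (ht : 0 ≤ t) (hδ : 0 ≤ δ) {y : ℝ → E n} {v : ℝ → E m} (hy : IsTrajectory P δ y v)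
    (hint : IntervalIntegrable (fun s => P.ℓ (y s) (v s)) volume 0 δ) :
    ((∫ s in (0 : ℝ)..δ, P.ℓ (y s) (v s) : ℝ) : EReal) + value P t (y δ) ≤
      value P (t + δ) (y 0) := by
  -- Moving the real integral to the right lets the supremum be bounded one continuation at a time.
  rw [add_comm, ← EReal.le_sub_iff_add_le (by simp) (by simp)]
  refine iSup_le fun x => iSup_le fun u => iSup_le fun hxu => ?_
  rw [EReal.le_sub_iff_add_le (by simp) (by simp)]
  obtain ⟨htr, hx0, hi⟩ := hxu
  set X : ℝ → E n := fun s => if s ≤ δ then y s else x (s - δ) with hX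
  set V : ℝ → E m := fun s => if s ≤ δ then v s else u (s - δ) with hV
  have hc : IsTrajectory P (t + δ) X V := hy.concat htr hx0 h1 hMf ht hδ
  have e1 : Set.EqOn (fun s => P.ℓ (y s) (v s)) (fun s => P.ℓ (X s) (V s)) (Set.uIoc 0 δ) := by
    intro s hs
    rw [Set.uIoc_of_le hδ] at hs
    simp [hX, hV, hs.2]
  have e2 : Set.EqOn (fun s => P.ℓ (x (s - δ)) (u (s - δ))) (fun s => P.ℓ (X s) (V s))
      (Set.uIoc δ (t + δ)) := by
    intro s hs
    rw [Set.uIoc_of_le (by linarith)] at hs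
    simp [hX, hV, not_le.2 hs.1]
  have hi1 := hint.congr e1
  have hi2 : IntervalIntegrable (fun s => P.ℓ (X s) (V s)) volume δ (t + δ) := by
    refine IntervalIntegrable.congr e2 ?_
    have := hi.comp_sub_right δ
    simpa using this
  have hXt : X (t + δ) = x t := by
    rcases ht.eq_or_lt with rfl | ht'
    · simp [hX, hx0]
    · simp [hX, ht']
  have hadm : IsAdmissible P (t + δ) (y 0) X V := ⟨hc, by simp [hX, hδ], hi1.trans hi2⟩
  refine le_trans (le_of_eq ?_) (le_iSup_of_le X (le_iSup_of_le V (le_iSup_of_le hadm le_rfl)))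
  rw [hXt, add_right_comm, ← EReal.coe_add,
    ← intervalIntegral.integral_add_adjacent_intervals hi1 hi2,
    ← intervalIntegral.integral_congr_ae (ae_of_all _ e1),
    ← intervalIntegral.integral_congr_ae (ae_of_all _ e2),
    intervalIntegral.integral_comp_sub_right (fun s => P.ℓ (x s) (u s)) δ]
  simp [add_comm]

/-! ### One-step consistency on quadratic elements -/

theorem quadElement_eq (c : ℝ) (xh x y : E n) :
    quadElement c xh y =
      quadElement c xh x + inner ℝ (-c • (x - xh)) (y - x) - c / 2 * ‖y - x‖ ^ 2 := by
  have h : y - xh = (x - xh) + (y - x) := by abel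
  unfold quadElement
  rw [h, norm_add_sq_real, real_inner_smul_left]
  ring

theorem gradient_quadElement (c : ℝ) (xh x : E n) :
    gradient (quadElement c xh) x = -c • (x - xh) := by
  refine HasGradientAt.gradient ?_
  rw [hasGradientAt_iff_hasFDerivAt]
  have h1 : HasFDerivAt (fun y : E n => ‖y - xh‖ ^ 2) (2 • innerSL ℝ (x - xh)) x := by
    simpa using ((hasFDerivAt_id x).sub_const xh).norm_sq
  have h2 := h1.const_mul (-(c / 2))
  convert! h2 using 1
  ext y
  simp
  ring

/-- The consistency constant of one step of the method. -/
noncomputable def stepConst (c Lf Mf Lℓ q : ℝ) : ℝ := (Lℓ + q * Lf) * Mf + c / 2 * Mf ^ 2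

/-- The element used is one that dominates `g` at the endpoint `x δ`, unknown in advance, so the
bound `B` must hold for every `i`. The curvature term of the expansion at `x₀` has a favourable sign
and is dropped. -/
theorem value_add_le_of_forall_exists {P : ControlProblem n m} {Lf Mf Lℓ Mℓ t δ c q e B : ℝ}
    (h1 : H1 P Lf Mf) (h2 : H2 P Lℓ Mℓ) (hLf : 0 ≤ Lf) (hLℓ : 0 ≤ Lℓ) (hMf : 0 ≤ Mf) (hc : 0 ≤ c)
    (ht : 0 ≤ t) (hδ : 0 ≤ δ) {g : E n → ℝ} (hg : ∀ y ∈ P.X, value P t y = g y)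
    {ι : Type*} {lam H : ι → ℝ} {xh : ι → E n} {x₀ : E n}
    (hq : ∀ i, ‖-c • (x₀ - xh i)‖ ≤ q)
    (hgl : ∀ y ∈ P.X, ∃ i, g y ≤ lam i + quadElement c (xh i) y + e)
    (hH : ∀ i, ∀ v ∈ P.U, P.ℓ x₀ v + inner ℝ (-c • (x₀ - xh i)) (P.f x₀ v) ≤ H i)
    (hB : ∀ i, lam i + quadElement c (xh i) x₀ + δ * H i ≤ B) :
    value P (t + δ) x₀ ≤ ((B + e + stepConst c Lf Mf Lℓ q * δ ^ 2 : ℝ) : EReal) := by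
  refine value_add_le h1 hMf ht hδ fun x u htr hx0 hint => ?_
  have hxδ : x δ ∈ P.X := htr.state_mem δ ⟨hδ, by linarith⟩
  obtain ⟨i, hi⟩ := hgl _ hxδ
  rw [hg _ hxδ, ← EReal.coe_add, EReal.coe_le_coe_iff]
  subst hx0
  have hest := htr.integral_add_inner_le h1 h2 hLf hLℓ hMf (-c • (x 0 - xh i)) hδ (by linarith)
    hint (hH i)
  rw [quadElement_eq c (xh i) (x 0) (x δ)] at hi
  have h3 : (Lℓ + ‖-c • (x 0 - xh i)‖ * Lf) * Mf * δ ^ 2 ≤ stepConst c Lf Mf Lℓ q * δ ^ 2 := by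
    refine mul_le_mul_of_nonneg_right ?_ (sq_nonneg δ)
    have : (Lℓ + ‖-c • (x 0 - xh i)‖ * Lf) * Mf ≤ (Lℓ + q * Lf) * Mf := by
      gcongr
      exact hq i
    unfold stepConst
    nlinarith [sq_nonneg Mf]
  have h4 : 0 ≤ c / 2 * ‖x δ - x 0‖ ^ 2 := by positivity
  linarith [hB i]

/-- The constant control `v` is a competitor. Here the curvature term counts against the estimate
and costs `c / 2 * (Mf * δ) ^ 2`, the second summand of `stepConst`. -/
theorem le_value_add_of_forall {P : ControlProblem n m} {T Lf Mf Lℓ Mℓ t δ c q e lam : ℝ}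
    (h1 : H1 P Lf Mf) (h2 : H2 P Lℓ Mℓ) (hfeas : ConstantControlsFeasible P T)
    (hLf : 0 ≤ Lf) (hLℓ : 0 ≤ Lℓ) (hMf : 0 ≤ Mf) (hc : 0 ≤ c)
    (ht : 0 ≤ t) (hδ : 0 ≤ δ) (hδT : δ ≤ T) {g : E n → ℝ} (hg : ∀ y ∈ P.X, value P t y = g y)
    {xh x₀ : E n} (hx₀ : x₀ ∈ P.X) (hq : ‖-c • (x₀ - xh)‖ ≤ q)
    (hgl : ∀ y ∈ P.X, lam + quadElement c xh y ≤ g y + e) {v : E m} (hv : v ∈ P.U) :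
    ((lam + quadElement c xh x₀ + δ * (P.ℓ x₀ v + inner ℝ (-c • (x₀ - xh)) (P.f x₀ v)) - e -
      stepConst c Lf Mf Lℓ q * δ ^ 2 : ℝ) : EReal) ≤ value P (t + δ) x₀ := by
  obtain ⟨y, hy0, hyT⟩ := hfeas x₀ hx₀ v hv
  have hy := hyT.restrict hδ hδT
  subst hy0
  have hint := hy.intervalIntegrable_const_control h2 hLℓ hδ
  refine le_trans ?_ (le_value_add h1 hMf ht hδ hy hint)
  have hyδ : y δ ∈ P.X := hy.state_mem δ ⟨hδ, le_rfl⟩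
  rw [hg _ hyδ, ← EReal.coe_add, EReal.coe_le_coe_iff]
  have hest := hy.le_integral_add_inner h1 h2 hLf hLℓ hMf (-c • (y 0 - xh)) hδ le_rfl hint
  have hi := hgl _ hyδ
  rw [quadElement_eq c xh (y 0) (y δ)] at hi
  have hd := hy.norm_sub_le h1 le_rfl hδ le_rfl
  rw [sub_zero] at hd
  have h3 : c / 2 * ‖y δ - y 0‖ ^ 2 ≤ c / 2 * (Mf * δ) ^ 2 := by gcongr
  have h4 : (Lℓ + ‖-c • (y 0 - xh)‖ * Lf) * Mf * δ ^ 2 ≤ (Lℓ + q * Lf) * Mf * δ ^ 2 := by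
    gcongr
  unfold stepConst
  linarith

/-! ### Projection errors of the two families of elements -/

/-- A convex function that lies above a downward cone at `x` has a subgradient at `x` whose norm
is at most the slope of the cone. -/
theorem exists_subgradient_norm_le {X : Set (E n)} {h : E n → ℝ} (hh : ConvexOn ℝ X h) {x : E n}
    (hx : x ∈ X) {L : ℝ} (hL : 0 ≤ L) (hlb : ∀ y ∈ X, h x - L * ‖y - x‖ ≤ h y) :
    ∃ p : E n, ‖p‖ ≤ L ∧ ∀ y ∈ X, h x + inner ℝ p (y - x) ≤ h y := by
  have hcone : ConcaveOn ℝ Set.univ fun y : E n => h x - L * ‖y - x‖ := by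
    refine (concaveOn_const _ convex_univ).sub ?_
    have h1 : ConvexOn ℝ Set.univ fun y : E n => ‖y - x‖ := by
      simpa [dist_eq_norm] using convexOn_univ_dist x
    simpa [smul_eq_mul] using h1.smul hL
  set s : Set (E n × ℝ) := {q | q.1 ∈ Set.univ ∧ q.2 < h x - L * ‖q.1 - x‖} with hs
  set t : Set (E n × ℝ) := {q | q.1 ∈ X ∧ h q.1 ≤ q.2} with ht
  have hso : IsOpen s := by
    simp only [hs, Set.mem_univ, true_and]
    exact isOpen_lt (by fun_prop) (by fun_prop)
  have hdisj : Disjoint s t := by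
    rw [Set.disjoint_left]
    rintro ⟨y, r⟩ ⟨-, h1⟩ ⟨h2, h3⟩
    dsimp only at h1 h2 h3
    linarith [hlb y h2]
  -- Separating the epigraph from the whole cone, not just from a point, bounds the slope and also
  -- handles boundary points of `X`.
  obtain ⟨F, w, hF1, hF2⟩ := geometric_hahn_banach_open hcone.convex_strict_hypograph hso
    hh.convex_epigraph hdisj
  set b : ℝ := F (0, 1) with hb
  set G : StrongDual ℝ (E n) := F.comp (ContinuousLinearMap.inl ℝ (E n) ℝ) with hG
  have hF : ∀ y r, F (y, r) = G y + b * r := by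
    intro y r
    have e : ((y, r) : E n × ℝ) = (y, 0) + r • (0, 1) := by simp
    rw [e, map_add, map_smul, smul_eq_mul, mul_comm r]
    rfl
  have hs' : ∀ y r, r < h x - L * ‖y - x‖ → G y + b * r < w := fun y r hr => by
    rw [← hF]
    exact hF1 (y, r) ⟨Set.mem_univ _, hr⟩
  have ht' : ∀ y ∈ X, w ≤ G y + b * h y := fun y hy => by
    rw [← hF]
    exact hF2 (y, h y) ⟨hy, le_rfl⟩
  -- The hyperplane is not vertical: it separates two points above the same `x`.
  have hbpos : 0 < b := by
    have e1 := hs' x (h x - 1) (by simp)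
    have e2 := ht' x hx
    nlinarith
  have hs'' : ∀ y, G y + b * (h x - L * ‖y - x‖) ≤ w := by
    intro y
    refine le_of_forall_pos_lt_add fun ε hε => ?_
    have e := hs' y (h x - L * ‖y - x‖ - ε / b) (by
      have := div_pos hε hbpos
      linarith)
    have e2 : b * (ε / b) = ε := by field_simp
    nlinarith
  have hwx : w = G x + b * h x := le_antisymm (ht' x hx) (by simpa using hs'' x)
  set p : E n := -b⁻¹ • (InnerProductSpace.toDual ℝ (E n)).symm G with hp
  have hpG : ∀ z, b * inner ℝ p z = -G z := by
    intro z
    rw [hp, real_inner_smul_left, InnerProductSpace.toDual_symm_apply]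
    field_simp
  refine ⟨p, ?_, fun y hy => ?_⟩
  · by_contra! hlt
    -- Testing the cone in the direction `-p` yields `‖p‖² ≤ L ‖p‖`.
    have e := hs'' (x - p)
    have e2 := hpG p
    rw [real_inner_self_eq_norm_sq] at e2
    rw [hwx, map_sub, sub_sub_cancel_left, norm_neg] at e
    have e3 : b * ‖p‖ ^ 2 ≤ b * (L * ‖p‖) := by linarith
    have e4 := le_of_mul_le_mul_left e3 hbpos
    nlinarith [norm_nonneg p]
  · have e := ht' y hy
    have e2 := hpG (y - x)
    rw [map_sub] at e2
    refine le_of_mul_le_mul_left ?_ hbpos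
    linarith

/-- A semiconvex Lipschitz function touches a quadratic function from above at every point, with a
centre at distance at most `L / c`. -/
theorem exists_quadElement_le {X : Set (E n)} {c L : ℝ} (hc : 0 < c) (hL : 0 ≤ L) {g : E n → ℝ}
    (hg : ConvexOn ℝ X fun x => g x + c / 2 * ‖x‖ ^ 2)
    (hLip : ∀ x ∈ X, ∀ y ∈ X, |g x - g y| ≤ L * ‖x - y‖) {x : E n} (hx : x ∈ X) :
    ∃ b : E n, ‖b‖ ≤ L / c ∧ ∀ y ∈ X,
      g x - quadElement c (x + b) x ≤ g y - quadElement c (x + b) y := by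
  -- Recentring the square at `x` adds an affine function, and makes the square vanish at `x`, so
  -- the Lipschitz cone of `g` still lies below.
  have hh : ConvexOn ℝ X fun y => g y + c / 2 * ‖y - x‖ ^ 2 := by
    have h1 : ConvexOn ℝ X fun y => (-c) * inner ℝ x y + c / 2 * ‖x‖ ^ 2 := by
      refine ConvexOn.add_const (f := fun y => (-c) * inner ℝ x y) ?_ (c / 2 * ‖x‖ ^ 2)
      exact ((-c) • (innerₛₗ ℝ x)).convexOn hg.1
    refine (hg.add h1).congr fun y _ => ?_
    simp only [Pi.add_apply]
    rw [norm_sub_sq_real, real_inner_comm]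
    ring
  obtain ⟨p, hpL, hp⟩ := exists_subgradient_norm_le hh hx hL fun y hy => by
    have e := (abs_le.1 (hLip x hx y hy)).2
    rw [norm_sub_rev x y] at e
    have : 0 ≤ c / 2 * ‖y - x‖ ^ 2 := by positivity
    simp only [sub_self, norm_zero]
    nlinarith
  -- With this offset the element has gradient `p` at `x`.
  refine ⟨c⁻¹ • p, ?_, fun y hy => ?_⟩
  · rw [norm_smul, norm_inv, Real.norm_of_nonneg hc.le, div_eq_inv_mul]
    gcongr
  · have e := hp y hy
    rw [quadElement_eq c _ x y]
    have e2 : -c • (x - (x + c⁻¹ • p)) = p := by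
      rw [sub_add_cancel_left, smul_neg, neg_smul, neg_neg, smul_inv_smul₀ hc.ne']
    rw [e2]
    simp only [sub_self, norm_zero] at e
    linarith

theorem voronoiRadius_nonneg (X : Set (E n)) (S : Finset (E n)) : 0 ≤ voronoiRadius X S :=
  Real.sSup_nonneg (by
    rintro r ⟨p, -, x, -, rfl⟩
    exact norm_nonneg _)

theorem exists_norm_sub_le_voronoiRadius {X : Set (E n)} (hX : Bornology.IsBounded X)
    {S : Finset (E n)} (hS : S.Nonempty) {x : E n} (hx : x ∈ X) :
    ∃ p : S, ‖x - p‖ ≤ voronoiRadius X S := by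
  obtain ⟨p, hp, hmin⟩ := S.exists_min_image (fun q => ‖x - q‖) hS
  refine ⟨⟨p, hp⟩, le_csSup ?_ ⟨p, hp, x, ⟨hmin, hx⟩, rfl⟩⟩
  obtain ⟨C, hC⟩ := (hX.union S.finite_toSet.isBounded).exists_norm_le
  refine ⟨C + C, ?_⟩
  rintro r ⟨q, hq, y, hy, rfl⟩
  exact (norm_sub_le _ _).trans (add_le_add (hC _ (Or.inl hy.2)) (hC _ (Or.inr hq)))

/-- Moving the centre of a quadratic element. -/
theorem quadElement_sub_sub (c : ℝ) (a b x y : E n) :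
    quadElement c a x - quadElement c a y - (quadElement c b x - quadElement c b y) =
      c * inner ℝ (a - b) (x - y) := by
  unfold quadElement
  simp only [norm_sub_sq_real, inner_sub_left, inner_sub_right, real_inner_comm]
  rw [real_inner_comm x a, real_inner_comm x b, real_inner_comm y a, real_inner_comm y b]
  ring

/-- The quadratic elements approximate a semiconvex Lipschitz function from below. -/
theorem exists_quadElement_sub_le {X : Set (E n)} (hX : Bornology.IsBounded X) {c L D ρ : ℝ}
    (hc : 0 < c) (hL : 0 ≤ L) (hD : Metric.diam X ≤ D) {g : E n → ℝ}
    (hg : ConvexOn ℝ X fun x => g x + c / 2 * ‖x‖ ^ 2)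
    (hLip : ∀ x ∈ X, ∀ y ∈ X, |g x - g y| ≤ L * ‖x - y‖) {Sh : Finset (E n)} (hSh : Sh.Nonempty)
    (hρ : voronoiRadius (X + Metric.closedBall 0 (L / c)) Sh ≤ ρ) {x : E n} (hx : x ∈ X) :
    ∃ i : Sh, ∀ y ∈ X,
      g x - quadElement c i x ≤ g y - quadElement c i y + c * D * ρ := by
  obtain ⟨b, hb, htouch⟩ := exists_quadElement_le hc hL hg hLip hx
  have hmem : x + b ∈ X + Metric.closedBall (0 : E n) (L / c) :=
    Set.add_mem_add hx (by simpa using hb)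
  obtain ⟨i, hi⟩ := exists_norm_sub_le_voronoiRadius
    (hX.add Metric.isBounded_closedBall) hSh hmem
  refine ⟨i, fun y hy => ?_⟩
  -- Elements of equal Hessian differ by an affine function, so the price of moving the centre is
  -- linear in the displacement.
  have e := quadElement_sub_sub c (x + b) i x y
  have hxy : ‖x - y‖ ≤ D := by
    rw [← dist_eq_norm]
    exact (Metric.dist_le_diam_of_mem hX hx hy).trans hD
  have e2 : inner ℝ (x + b - i) (x - y) ≤ ρ * D :=
    (real_inner_le_norm _ _).trans (mul_le_mul (hi.trans hρ) hxy (norm_nonneg _)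
      ((norm_nonneg _).trans (hi.trans hρ)))
  have e3 := mul_le_mul_of_nonneg_left e2 hc.le
  linarith [htouch y hy]

theorem norm_le_sum_abs (x : E n) : ‖x‖ ≤ ∑ i, |x i| := by
  rw [EuclideanSpace.norm_eq, Real.sqrt_le_left (Finset.sum_nonneg fun i _ => abs_nonneg _)]
  simpa using Finset.sum_sq_le_sq_sum_of_nonneg (s := Finset.univ) (f := fun i => |x i|)
    fun i _ => abs_nonneg _

theorem sum_abs_le (x : E n) : ∑ i, |x i| ≤ n * ‖x‖ := by
  refine (Finset.sum_le_sum fun i _ => PiLp.norm_apply_le x i).trans ?_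
  simp

/-- The Lipschitz elements test a Lipschitz function at `x` up to the distance of `x` to the
nearest centre. -/
theorem exists_lipElement_le {X : Set (E n)} (hX : Bornology.IsBounded X) {a L ρ : ℝ}
    (hL : 0 ≤ L) (ha : L ≤ a) {g : E n → ℝ}
    (hLip : ∀ x ∈ X, ∀ y ∈ X, |g x - g y| ≤ L * ‖x - y‖) {S : Finset (E n)} (hS : S.Nonempty)
    (hρ : voronoiRadius X S ≤ ρ) {x : E n} (hx : x ∈ X) :
    ∃ j : S, ∀ y ∈ X, lipElement a j y + g y ≤ lipElement a j x + g x + 2 * a * n * ρ := by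
  obtain ⟨j, hj⟩ := exists_norm_sub_le_voronoiRadius hX hS hx
  refine ⟨j, fun y hy => ?_⟩
  have ha0 : 0 ≤ a := hL.trans ha
  have e1 := (abs_le.1 (hLip y hy x hx)).2
  -- Passing through the centre cancels `z_j y` and leaves `‖x - ŷ_j‖₁` twice: the factor `2`.
  have e2 : L * ‖y - x‖ ≤ a * (∑ i, |y i - (j : E n) i| + ∑ i, |x i - (j : E n) i|) := by
    refine mul_le_mul ha ((norm_le_sum_abs _).trans ?_) (norm_nonneg _) ha0
    rw [← Finset.sum_add_distrib]
    refine Finset.sum_le_sum fun i _ => ?_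
    rw [PiLp.sub_apply, abs_sub_comm (x i)]
    exact abs_sub_le (y i) ((j : E n) i) (x i)
  have e3 : ∑ i, |x i - (j : E n) i| ≤ n * ρ :=
    (sum_abs_le (x - (j : E n))).trans (mul_le_mul_of_nonneg_left (hj.trans hρ) (Nat.cast_nonneg n))
  have e4 := mul_le_mul_of_nonneg_left e3 ha0
  unfold lipElement
  linarith

/-! ### Reduction to real coefficients and accumulation of errors -/

theorem coe_ciSup {ι : Type*} [Nonempty ι] {f : ι → ℝ} (hf : BddAbove (Set.range f)) :
    ((⨆ i, f i : ℝ) : EReal) = ⨆ i, (f i : EReal) :=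
  EReal.coe_strictMono.monotone.map_ciSup_of_continuousAt
    continuous_coe_real_ereal.continuousAt hf

theorem coe_ciInf {ι : Type*} [Nonempty ι] {f : ι → ℝ} (hf : BddBelow (Set.range f)) :
    ((⨅ i, f i : ℝ) : EReal) = ⨅ i, (f i : EReal) :=
  EReal.coe_strictMono.monotone.map_ciInf_of_continuousAt
    continuous_coe_real_ereal.continuousAt hf

theorem residual_coe (a b : ℝ) : residual (a : EReal) (b : EReal) = ((b - a : ℝ) : EReal) := by
  refine le_antisymm (sSup_le fun r hr => ?_) (le_sSup ?_)
  · rw [EReal.coe_sub, EReal.le_sub_iff_add_le (by simp) (by simp), add_comm]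
    exact hr
  · change (a : EReal) + ((b - a : ℝ) : EReal) ≤ b
    rw [← EReal.coe_add, add_sub_cancel]

theorem mulVec_coe {I J : Type*} [Finite I] [Nonempty I] (A : J → I → ℝ) (v : I → ℝ) (j : J) :
    mulVec (fun j i => (A j i : EReal)) (fun i => (v i : EReal)) j =
      ((⨆ i, (A j i + v i) : ℝ) : EReal) := by
  rw [coe_ciSup (Set.finite_range _).bddAbove]
  simp [mulVec]

theorem residualVec_coe {I J : Type*} [Nonempty J] (A : J → I → ℝ) (v : J → ℝ) (i : I)
    (h : BddBelow (Set.range fun j => v j - A j i)) :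
    residualVec (fun j i => (A j i : EReal)) (fun j => (v j : EReal)) i =
      ((⨅ j, (v j - A j i) : ℝ) : EReal) := by
  rw [coe_ciInf h]
  simp only [residualVec, residual_coe]

/-- The recursion `λ ↦ M \ (K λ)` on real vectors. -/
noncomputable def realCoeff {I J : Type*} (M K : J → I → ℝ) (lam₀ : I → ℝ) : ℕ → I → ℝ
  | 0 => lam₀
  | k + 1 => fun i => ⨅ j, ((⨆ i', (K j i' + realCoeff M K lam₀ k i')) - M j i)

theorem coeff_eq_realCoeff (P : ControlProblem n m) (c a : ℝ) (S Sh : Finset (E n)) [Nonempty S]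
    [Nonempty Sh] (K' : S → Sh → EReal) {M K : S → Sh → ℝ} {lam₀ : Sh → ℝ}
    (hM : ∀ j i, matM P c a S Sh j i = M j i) (hK : ∀ j i, K' j i = K j i)
    (h0 : ∀ i, residualVec (matW P c Sh) (fun x : P.X => P.φ x) i = lam₀ i) (k : ℕ) :
    coeff P c a S Sh K' k = fun i => (realCoeff M K lam₀ k i : EReal) := by
  have hM' : matM P c a S Sh = fun j i => (M j i : EReal) := funext fun j => funext (hM j)
  have hK'' : K' = fun j i => (K j i : EReal) := funext fun j => funext (hK j)
  induction k with
  | zero => exact funext h0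
  | succ k ih =>
    funext i
    have e : mulVec (fun j i => (K j i : EReal)) (fun i => (realCoeff M K lam₀ k i : EReal)) =
        fun j => ((⨆ i, (K j i + realCoeff M K lam₀ k i) : ℝ) : EReal) :=
      funext fun j => mulVec_coe _ _ j
    rw [coeff, ih, hM', hK'', e, residualVec_coe _ _ _ (Set.finite_range _).bddBelow]
    rfl

/-- Accumulation of the projection errors `ρ₁`, `ρ₂` and of the consistency error `ε`. -/
theorem realCoeff_error {F I J : Type*} [Finite I] [Nonempty I] [Finite J] [Nonempty J]
    {X : Set F} {w : I → F → ℝ} {z : J → F → ℝ} {M K : J → I → ℝ} {lam₀ : I → ℝ} {V : ℕ → F → ℝ}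
    {N : ℕ} {ρ₁ ρ₂ ε : ℝ} (hρ₂ : 0 ≤ ρ₂)
    (hM1 : ∀ j i, ∀ x ∈ X, z j x + w i x ≤ M j i)
    (hM2 : ∀ j i B, (∀ x ∈ X, z j x + w i x ≤ B) → M j i ≤ B)
    (h01 : ∀ i, ∀ x ∈ X, lam₀ i + w i x ≤ V 0 x)
    (h02 : ∀ i r, (∀ x ∈ X, r + w i x ≤ V 0 x) → r ≤ lam₀ i)
    (hup : ∀ k < N, ∀ (lam : I → ℝ) (e : ℝ), (∀ y ∈ X, ∃ i, V k y ≤ lam i + w i y + e) →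
      ∀ j B, (∀ i, K j i + lam i ≤ B) → ∀ x ∈ X, z j x + V (k + 1) x ≤ B + e + ε)
    (hlow : ∀ k < N, ∀ (lam : I → ℝ) (e : ℝ), (∀ i, ∀ y ∈ X, lam i + w i y ≤ V k y + e) →
      ∀ j B, (∀ x ∈ X, z j x + V (k + 1) x ≤ B) → ∀ i, K j i + lam i ≤ B + e + ε)
    (hp1 : ∀ k ≤ N, ∀ x ∈ X, ∃ i, ∀ y ∈ X, V k x - w i x ≤ V k y - w i y + ρ₁)
    (hp2 : ∀ k ≤ N, ∀ x ∈ X, ∃ j, ∀ y ∈ X, z j y + V k y ≤ z j x + V k x + ρ₂) (k : ℕ)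
    (hk : k ≤ N) :
    (∀ i, ∀ x ∈ X, realCoeff M K lam₀ k i + w i x ≤ V k x + (k * (ε + ρ₂) + ρ₂)) ∧
      ∀ x ∈ X, ∃ i, V k x ≤ realCoeff M K lam₀ k i + w i x + (k * (ε + ρ₁) + ρ₁) := by
  induction k with
  | zero =>
    refine ⟨fun i x hx => ?_, fun x hx => ?_⟩
    · have := h01 i x hx
      simp only [Nat.cast_zero, zero_mul, zero_add]
      exact this.trans (by linarith)
    · obtain ⟨i, hi⟩ := hp1 0 hk x hx
      refine ⟨i, ?_⟩
      have := h02 i (V 0 x - w i x - ρ₁) fun y hy => by linarith [hi y hy]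
      simp only [Nat.cast_zero, zero_mul, zero_add, realCoeff]
      linarith
  | succ k ih =>
    obtain ⟨ih1, ih2⟩ := ih (by omega)
    set lam := realCoeff M K lam₀ k with hlam
    have hmu : ∀ j i, K j i + lam i ≤ ⨆ i', (K j i' + lam i') := fun j i =>
      le_ciSup (f := fun i' => K j i' + lam i') (Set.finite_range _).bddAbove i
    push_cast
    refine ⟨fun i x hx => ?_, fun x hx => ?_⟩
    -- Upper bound: a single row of the minimum suffices, that of a test function almost maximal
    -- against `V (k + 1)` at `x`.
    · obtain ⟨j, hj⟩ := hp2 (k + 1) hk x hx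
      have e1 := hlow k (by omega) lam _ ih1 j _ hj
      have e2 : realCoeff M K lam₀ (k + 1) i ≤ (⨆ i', (K j i' + lam i')) - M j i :=
        ciInf_le (f := fun j => (⨆ i', (K j i' + lam i')) - M j i)
          (Set.finite_range _).bddBelow j
      have e3 := ciSup_le e1
      linarith [hM1 j i x hx]
    -- Lower bound: `i` almost touches `V (k + 1)` at `x` from below, and then every row of the
    -- minimum is controlled.
    · obtain ⟨i, hi⟩ := hp1 (k + 1) hk x hx
      refine ⟨i, ?_⟩
      have e : V (k + 1) x - w i x - ρ₁ - (k * (ε + ρ₁) + ρ₁) - ε ≤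
          realCoeff M K lam₀ (k + 1) i := by
        refine le_ciInf fun j => ?_
        rw [le_sub_comm]
        refine hM2 j i _ fun y hy => ?_
        have e1 := hup k (by omega) lam _ ih2 j _ (hmu j) y hy
        linarith [hi y hy]
      linarith

/-! ### The Hamiltonian along quadratic elements -/

/-- The real-valued Hamiltonian along the gradient of a quadratic element. -/
noncomputable def quadHam (P : ControlProblem n m) (c : ℝ) (xh x : E n) : ℝ :=
  ⨆ v : P.U, (P.ℓ x v + inner ℝ (-c • (x - xh)) (P.f x v))

section Hamiltonian

variable {P : ControlProblem n m} {c Lf Mf Lℓ Mℓ q : ℝ}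

theorem abs_reward_le (h1 : H1 P Lf Mf) (h2 : H2 P Lℓ Mℓ) {p x : E n} (hx : x ∈ P.X)
    (hp : ‖p‖ ≤ q) {v : E m} (hv : v ∈ P.U) :
    |P.ℓ x v + inner ℝ p (P.f x v)| ≤ Mℓ + q * Mf :=
  (abs_add_le _ _).trans (add_le_add (h2.2 x hx v hv) ((abs_real_inner_le_norm _ _).trans
    (mul_le_mul hp (h1.2 x hx v hv) (norm_nonneg _) ((norm_nonneg _).trans hp))))

theorem bddAbove_reward (h1 : H1 P Lf Mf) (h2 : H2 P Lℓ Mℓ) (p : E n) {x : E n} (hx : x ∈ P.X) :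
    BddAbove (Set.range fun v : P.U => P.ℓ x v + inner ℝ p (P.f x v)) := by
  refine ⟨Mℓ + ‖p‖ * Mf, ?_⟩
  rintro r ⟨v, rfl⟩
  exact (abs_le.1 (abs_reward_le h1 h2 hx le_rfl v.2)).2

theorem le_quadHam (h1 : H1 P Lf Mf) (h2 : H2 P Lℓ Mℓ) {x : E n} (hx : x ∈ P.X) (xh : E n)
    {v : E m} (hv : v ∈ P.U) :
    P.ℓ x v + inner ℝ (-c • (x - xh)) (P.f x v) ≤ quadHam P c xh x :=
  le_ciSup (bddAbove_reward h1 h2 (-c • (x - xh)) hx) ⟨v, hv⟩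

theorem abs_quadHam_le (hU : P.U.Nonempty) (h1 : H1 P Lf Mf) (h2 : H2 P Lℓ Mℓ) {x : E n}
    (hx : x ∈ P.X) {xh : E n} (hq : ‖-c • (x - xh)‖ ≤ q) :
    |quadHam P c xh x| ≤ Mℓ + q * Mf := by
  obtain ⟨v, hv⟩ := hU
  have : Nonempty P.U := ⟨⟨v, hv⟩⟩
  rw [abs_le]
  exact ⟨(abs_le.1 (abs_reward_le h1 h2 hx hq hv)).1.trans (le_quadHam h1 h2 hx xh hv),
    ciSup_le fun u => (abs_le.1 (abs_reward_le h1 h2 hx hq u.2)).2⟩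

theorem hamGrad_quadElement (hU : P.U.Nonempty) (h1 : H1 P Lf Mf) (h2 : H2 P Lℓ Mℓ) {x : E n}
    (hx : x ∈ P.X) (xh : E n) :
    hamGrad P (quadElement c xh) x = quadHam P c xh x := by
  have : Nonempty P.U := hU.to_subtype
  rw [hamGrad, gradient_quadElement, hamiltonian, quadHam, coe_ciSup (bddAbove_reward h1 h2 _ hx),
    iSup_subtype']

/-- The state dependence contributes `Lℓ + q Lf`; the gradient is `c`-Lipschitz in the state and
contributes `c Mf`. -/
theorem quadHam_le_add (hU : P.U.Nonempty) (h1 : H1 P Lf Mf) (h2 : H2 P Lℓ Mℓ) (hc : 0 ≤ c)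
    {x y : E n} (hx : x ∈ P.X) (hy : y ∈ P.X) {xh : E n}
    (hq : ‖-c • (x - xh)‖ ≤ q) :
    quadHam P c xh x ≤ quadHam P c xh y + (Lℓ + q * Lf + c * Mf) * ‖x - y‖ := by
  have : Nonempty P.U := hU.to_subtype
  refine ciSup_le fun v => ?_
  have e1 := (abs_le.1 (h2.1 x hx y hy v v.2)).2
  have e2 : inner ℝ (-c • (x - xh)) (P.f x v - P.f y v) ≤ q * (Lf * ‖x - y‖) :=
    (real_inner_le_norm _ _).trans (mul_le_mul hq (h1.1 x hx y hy v v.2) (norm_nonneg _)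
      ((norm_nonneg _).trans hq))
  have e3 : inner ℝ (-c • (x - y)) (P.f y v) ≤ c * ‖x - y‖ * Mf := by
    refine (real_inner_le_norm _ _).trans ?_
    rw [norm_smul, norm_neg, Real.norm_of_nonneg hc]
    exact mul_le_mul_of_nonneg_left (h1.2 y hy v v.2) (by positivity)
  have e4 : -c • (x - y) = -c • (x - xh) - -c • (y - xh) := by
    rw [← smul_sub, sub_sub_sub_cancel_right]
  rw [e4, inner_sub_left] at e3
  rw [inner_sub_right] at e2
  have e5 := le_quadHam (c := c) h1 h2 hy xh v.2
  linarith

end Hamiltonian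

/-! ### The stiffness matrices and the initial coefficients -/

/-- Quadratic growth of `z + w` away from a maximizer. -/
theorem add_le_of_isMax {X : Set (E n)} (hX : Convex ℝ X) {a c : ℝ} (ha : 0 ≤ a) {yh xh xs : E n}
    (hxs : xs ∈ X)
    (hmax : ∀ x ∈ X, lipElement a yh x + quadElement c xh x ≤
      lipElement a yh xs + quadElement c xh xs) {x : E n} (hx : x ∈ X) :
    lipElement a yh x + quadElement c xh x ≤
      lipElement a yh xs + quadElement c xh xs - c / 4 * ‖x - xs‖ ^ 2 := by
  -- Maximality is used only at the midpoint: the gain `c / 8` there doubles to `c / 4`.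
  set y : E n := (1 / 2 : ℝ) • x + (1 / 2 : ℝ) • xs with hy
  have hmid := hmax y (hX hx hxs (by norm_num) (by norm_num) (by norm_num))
  have e1 : quadElement c xh y =
      (quadElement c xh x + quadElement c xh xs) / 2 + c / 8 * ‖x - xs‖ ^ 2 := by
    have h1 : y - xh = (1 / 2 : ℝ) • ((x - xh) + (xs - xh)) := by
      rw [hy]
      module
    have h2 : x - xs = (x - xh) - (xs - xh) := by abel
    unfold quadElement
    rw [h1, h2, norm_smul, mul_pow, norm_add_sq_real, norm_sub_sq_real (x - xh) (xs - xh)]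
    norm_num
    ring
  have e2 : (lipElement a yh x + lipElement a yh xs) / 2 ≤ lipElement a yh y := by
    have h : ∑ i, |y i - yh i| ≤ (∑ i, |x i - yh i| + ∑ i, |xs i - yh i|) / 2 := by
      rw [← Finset.sum_add_distrib, Finset.sum_div]
      refine Finset.sum_le_sum fun i _ => ?_
      have : y i - yh i = ((x i - yh i) + (xs i - yh i)) / 2 := by
        simp [hy]
        ring
      rw [this, abs_div, abs_two]
      exact div_le_div_of_nonneg_right (abs_add_le _ _) (by norm_num)
    unfold lipElement
    nlinarith
  linarith

theorem continuous_quadElement (c : ℝ) (xh : E n) : Continuous (quadElement c xh) := by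
  unfold quadElement
  fun_prop

theorem continuous_lipElement (a : ℝ) (yh : E n) : Continuous (lipElement a yh) := by
  unfold lipElement
  fun_prop

theorem matM_eq_coe {P : ControlProblem n m} (hX : IsCompact P.X) (hXne : P.X.Nonempty) (c a : ℝ)
    (S Sh : Finset (E n)) (j : S) (i : Sh) :
    ∃ xs ∈ P.X, (∀ x ∈ P.X, lipElement a j x + quadElement c i x ≤
        lipElement a j xs + quadElement c i xs) ∧
      matM P c a S Sh j i = ((lipElement a j xs + quadElement c i xs : ℝ) : EReal) := by
  obtain ⟨xs, hxs, hmax⟩ := hX.exists_isMaxOn hXne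
    ((continuous_lipElement a j).add (continuous_quadElement c i)).continuousOn
  refine ⟨xs, hxs, hmax, le_antisymm (iSup_le fun x => ?_) (le_iSup_of_le ⟨xs, hxs⟩ ?_)⟩
  · rw [← EReal.coe_add, EReal.coe_le_coe_iff]
    exact hmax x.2
  · rw [← EReal.coe_add]

/-- The stiffness matrix `K_{H,h}` is real, and its entries are suprema of real functions. -/
theorem matKH_eq_coe {P : ControlProblem n m} (hX : IsCompact P.X) (hXne : P.X.Nonempty)
    (hU : P.U.Nonempty) {Lf Mf Lℓ Mℓ c a q δ : ℝ} (h1 : H1 P Lf Mf) (h2 : H2 P Lℓ Mℓ)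
    (hδ : 0 ≤ δ) {S Sh : Finset (E n)}
    (hq : ∀ i ∈ Sh, ∀ x ∈ P.X, ‖-c • (x - i)‖ ≤ q) (j : S) (i : Sh) :
    ∃ K : ℝ, matKH P c a δ S Sh j i = K ∧
      (∀ x ∈ P.X, lipElement a j x + quadElement c i x + δ * quadHam P c i x ≤ K) ∧
      ∀ B, (∀ x ∈ P.X, lipElement a j x + quadElement c i x + δ * quadHam P c i x ≤ B) →
        K ≤ B := by
  have : Nonempty P.X := hXne.to_subtype
  obtain ⟨xs, hxs, hmax, -⟩ := matM_eq_coe hX hXne c a S Sh j i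
  have hbdd : BddAbove (Set.range fun x : P.X =>
      lipElement a j (x : E n) + quadElement c i (x : E n) + δ * quadHam P c i (x : E n)) := by
    refine ⟨lipElement a j xs + quadElement c i xs + δ * (Mℓ + q * Mf), ?_⟩
    rintro r ⟨x, rfl⟩
    exact add_le_add (hmax x x.2) (mul_le_mul_of_nonneg_left
      (abs_le.1 (abs_quadHam_le hU h1 h2 x.2 (hq i i.2 x x.2))).2 hδ)
  refine ⟨⨆ x : P.X, (lipElement a j (x : E n) + quadElement c i (x : E n) +
    δ * quadHam P c i (x : E n)), ?_,
    fun x hx => le_ciSup hbdd ⟨x, hx⟩, fun B hB => ciSup_le fun x => hB x x.2⟩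
  rw [coe_ciSup hbdd]
  refine iSup_congr fun x => ?_
  simp only [approxStep, hamGrad_quadElement hU h1 h2 x.2, EReal.coe_add, EReal.coe_mul,
    add_assoc]

/-- The matrix `K̃_{H,h}` is real; it is below `K_{H,h}`, up to an error of order `δ²`. -/
theorem matKHt_eq_coe {P : ControlProblem n m} (hX : IsCompact P.X) (hXc : Convex ℝ P.X)
    (hXne : P.X.Nonempty) (hU : P.U.Nonempty) {Lf Mf Lℓ Mℓ c a q δ : ℝ} (h1 : H1 P Lf Mf)
    (h2 : H2 P Lℓ Mℓ) (hc : 0 < c) (ha : 0 ≤ a) (hδ : 0 ≤ δ) {S Sh : Finset (E n)}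
    (hq : ∀ i ∈ Sh, ∀ x ∈ P.X, ‖-c • (x - i)‖ ≤ q) (j : S) (i : Sh) :
    ∃ K : ℝ, matKHt P c a δ S Sh j i = K ∧
      (∀ x ∈ P.X, lipElement a j x + quadElement c i x + δ * quadHam P c i x ≤
        K + (Lℓ + q * Lf + c * Mf) ^ 2 / c * δ ^ 2) ∧
      ∀ B, (∀ x ∈ P.X, lipElement a j x + quadElement c i x + δ * quadHam P c i x ≤ B) →
        K ≤ B := by
  obtain ⟨xs, hxs, hmax, hM⟩ := matM_eq_coe hX hXne c a S Sh j i
  change scalarProdOn P.X (lipElement a j) (quadElement c i) = _ at hM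
  have harg : ∀ x, x ∈ argmaxOn P.X (lipElement a j) (quadElement c i) ↔ x ∈ P.X ∧
      lipElement a j x + quadElement c i x = lipElement a j xs + quadElement c i xs := by
    intro x
    simp only [argmaxOn, hM, Set.mem_ofPred_eq, ← EReal.coe_add, EReal.coe_eq_coe_iff]
  set A := argmaxOn P.X (lipElement a j) (quadElement c i) with hA
  have hxsA : xs ∈ A := (harg xs).2 ⟨hxs, rfl⟩
  have : Nonempty A := ⟨⟨xs, hxsA⟩⟩
  have hbdd : BddAbove (Set.range fun x : A => quadHam P c i x) := by
    refine ⟨Mℓ + q * Mf, ?_⟩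
    rintro r ⟨x, rfl⟩
    have hx := ((harg x).1 x.2).1
    exact (abs_le.1 (abs_quadHam_le hU h1 h2 hx (hq i i.2 x hx))).2
  refine ⟨lipElement a j xs + quadElement c i xs + δ * ⨆ x : A, quadHam P c i x, ?_,
    fun x hx => ?_, fun B hB => ?_⟩
  · rw [matKHt, hM, ← hA, iSup_subtype', EReal.coe_add _ (δ * _), EReal.coe_mul,
      coe_ciSup hbdd]
    congr 2
    exact iSup_congr fun x => hamGrad_quadElement hU h1 h2 ((harg x).1 x.2).1 _
  · have e1 := add_le_of_isMax hXc ha hxs hmax hx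
    have e2 := quadHam_le_add hU h1 h2 hc.le hx hxs (hq i i.2 x hx)
    have e3 : quadHam P c i xs ≤ ⨆ x : A, quadHam P c i x := le_ciSup hbdd ⟨xs, hxsA⟩
    have e4 := mul_le_mul_of_nonneg_left (e2.trans (add_le_add_left e3 _)) hδ
    -- Completing the square: the quadratic drop of `z + w` absorbs the linear variation of `δ H` up
    -- to `O(δ²)`.
    have e5 : δ * ((Lℓ + q * Lf + c * Mf) * ‖x - xs‖) ≤
        c / 4 * ‖x - xs‖ ^ 2 + (Lℓ + q * Lf + c * Mf) ^ 2 / c * δ ^ 2 := by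
      set Λ := Lℓ + q * Lf + c * Mf
      have h : c / 4 * ‖x - xs‖ ^ 2 + Λ ^ 2 / c * δ ^ 2 - δ * (Λ * ‖x - xs‖) =
          c⁻¹ * (c / 2 * ‖x - xs‖ - Λ * δ) ^ 2 := by
        field_simp
        ring
      have : 0 ≤ c⁻¹ * (c / 2 * ‖x - xs‖ - Λ * δ) ^ 2 := by positivity
      linarith
    linarith
  · rcases hδ.eq_or_lt with rfl | hδ'
    · simpa using hB xs hxs
    · have e : ⨆ x : A, quadHam P c i x ≤
          (B - (lipElement a j xs + quadElement c i xs)) / δ := by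
        refine ciSup_le fun x => ?_
        obtain ⟨hx, hxe⟩ := (harg x).1 x.2
        rw [le_div_iff₀ hδ', ← hxe]
        linarith [hB x hx]
      rw [le_div_iff₀ hδ'] at e
      linarith

/-- The initial coefficients are real, and are infima of real functions. -/
theorem coeff_zero_eq_coe {P : ControlProblem n m} (hX : IsCompact P.X) (hXne : P.X.Nonempty)
    (c : ℝ) {Sh : Finset (E n)} {L : ℝ} (hL : 0 ≤ L) {g : E n → ℝ} (hφ : ∀ x ∈ P.X, P.φ x = g x)
    (hLip : ∀ x ∈ P.X, ∀ y ∈ P.X, |g x - g y| ≤ L * ‖x - y‖) (i : Sh) :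
    ∃ r : ℝ, residualVec (matW P c Sh) (fun x : P.X => P.φ x) i = r ∧
      (∀ x ∈ P.X, r + quadElement c i x ≤ g x) ∧
      ∀ s, (∀ x ∈ P.X, s + quadElement c i x ≤ g x) → s ≤ r := by
  have : Nonempty P.X := hXne.to_subtype
  let W : P.X → Sh → ℝ := fun x i => quadElement c (i : E n) (x : E n)
  have hbdd : BddBelow (Set.range fun x : P.X => g (x : E n) - W x i) := by
    have hl : LipschitzOnWith ⟨L, hL⟩ g P.X := LipschitzOnWith.of_dist_le_mul fun x hx y hy => by
      rw [Real.dist_eq, dist_eq_norm]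
      exact hLip x hx y hy
    have hcont : ContinuousOn (fun x => g x - quadElement c (i : E n) x) P.X :=
      hl.continuousOn.sub (continuous_quadElement c (i : E n)).continuousOn
    have := (hX.image_of_continuousOn hcont).bddBelow
    rwa [Set.image_eq_range] at this
  refine ⟨⨅ x : P.X, (g (x : E n) - W x i), ?_, fun x hx => ?_,
    fun s hs => le_ciInf fun x => le_sub_iff_add_le.2 (hs x x.2)⟩
  · have e : (fun x : P.X => P.φ x) = fun x : P.X => (g (x : E n) : EReal) :=
      funext fun x => hφ x x.2
    have hW : matW P c Sh = fun (x : P.X) (i : Sh) => (W x i : EReal) := rfl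
    rw [e, hW]
    exact residualVec_coe W (fun x : P.X => g (x : E n)) i hbdd
  · exact le_sub_iff_add_le.1 (ciInf_le hbdd ⟨x, hx⟩)

/-! ### Assembly of the error bound -/

/-- Error of the method for every stiffness matrix that agrees with `K_{H,h}` up to `G δ²`. -/
theorem supNorm_approxValue_sub_le {P : ControlProblem n m} {T c L a D Lf Mf Lℓ Mℓ q δ Δx G : ℝ}
    (hT : 0 < T) (hc : 0 < c) (hL : 0 ≤ L) (ha : L ≤ a) (hLf : 0 ≤ Lf) (hMf : 0 ≤ Mf)
    (hLℓ : 0 ≤ Lℓ) (hq0 : 0 ≤ q) (hG : 0 ≤ G) (hX : IsCompact P.X)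
    (hXne : P.X.Nonempty) (hD : Metric.diam P.X ≤ D) (h1 : H1 P Lf Mf) (h2 : H2 P Lℓ Mℓ)
    (hfeas : ConstantControlsFeasible P T) (hU : P.U.Nonempty)
    (hv : ∀ t ∈ Set.Icc (0 : ℝ) T, SemiconvexLipschitzOn P.X c L (value P t))
    {S Sh : Finset (E n)} (hS : S.Nonempty) (hSh : Sh.Nonempty)
    (hq : ∀ i ∈ Sh, ∀ x ∈ P.X, ‖-c • (x - i)‖ ≤ q) {N : ℕ} (hN : 0 < N) (hδ : δ = T / N)
    (hρ : voronoiRadius P.X S ≤ Δx)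
    (hρh : voronoiRadius (P.X + Metric.closedBall 0 (L / c)) Sh ≤ Δx) {K' : S → Sh → EReal}
    {K : S → Sh → ℝ} (hK : ∀ j i, K' j i = K j i)
    (hK1 : ∀ (j : S) (i : Sh), ∀ x ∈ P.X, lipElement a j x + quadElement c i x + δ * quadHam P c i x ≤
      K j i + G * δ ^ 2)
    (hK2 : ∀ (j : S) (i : Sh) (B : ℝ), (∀ x ∈ P.X,
      lipElement a j x + quadElement c i x + δ * quadHam P c i x ≤ B) → K j i ≤ B) :
    supNorm (fun x : P.X => approxValue P c a S Sh K' N x - value P T x) ≤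
      ENNReal.ofReal ((T * (stepConst c Lf Mf Lℓ q + G) + 2 * T * (c * D + 2 * a * n)) *
        (δ + Δx / δ)) := by
  have : Nonempty S := hS.to_subtype
  have : Nonempty Sh := hSh.to_subtype
  have : Nonempty P.U := hU.to_subtype
  have : Nonempty P.X := hXne.to_subtype
  have hNR : (0 : ℝ) < N := Nat.cast_pos.2 hN
  have hδ0 : 0 < δ := hδ ▸ div_pos hT hNR
  have hNδ : N * δ = T := by rw [hδ]; field_simp
  have ha0 : 0 ≤ a := hL.trans ha
  have hD0 : 0 ≤ D := Metric.diam_nonneg.trans hD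
  have hΔ0 : 0 ≤ Δx := (voronoiRadius_nonneg _ _).trans hρ
  have htime : ∀ k : ℕ, k ≤ N → (k : ℝ) * δ ∈ Set.Icc (0 : ℝ) T := fun k hk =>
    ⟨by positivity, by
      rw [← hNδ]
      exact mul_le_mul_of_nonneg_right (Nat.cast_le.2 hk) hδ0.le⟩
  have hδT : δ ≤ T := by simpa using (htime 1 hN).2
  have hex : ∀ k : ℕ, k ≤ N → SemiconvexLipschitzOn P.X c L (value P (k * δ)) :=
    fun k hk => hv _ (htime k hk)
  choose! V hVval hVconv hVlip using hex
  choose xs hxs hmax hM using matM_eq_coe hX hXne c a S Sh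
  have hφ : ∀ x ∈ P.X, P.φ x = V 0 x := fun x hx => by
    have e := hVval 0 (Nat.zero_le _) x hx
    rw [Nat.cast_zero, zero_mul] at e
    rw [← e, value_zero (by rw [e]; exact EReal.coe_ne_bot _)]
  choose lam₀ hlam hlam1 hlam2 using coeff_zero_eq_coe hX hXne c (Sh := Sh) hL hφ
    (hVlip 0 (Nat.zero_le _))
  have hcoeff := coeff_eq_realCoeff P c a S Sh K' hM hK hlam N
  have hsucc : ∀ k : ℕ, ((k + 1 : ℕ) : ℝ) * δ = k * δ + δ := fun k => by push_cast; ring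
  have herr := realCoeff_error (X := P.X) (w := fun (i : Sh) x => quadElement c i x)
    (z := fun (j : S) x => lipElement a j x)
    (M := fun j i => lipElement a j (xs j i) + quadElement c i (xs j i)) (K := K) (lam₀ := lam₀)
    (V := V) (N := N) (ρ₁ := c * D * Δx) (ρ₂ := 2 * a * n * Δx)
    (ε := (stepConst c Lf Mf Lℓ q + G) * δ ^ 2) (by positivity) hmax
    (fun j i B hB => hB _ (hxs j i))
    hlam1 hlam2
    (by
      intro k hk lam e hgl j B hB x hx
      have h := value_add_le_of_forall_exists h1 h2 hLf hLℓ hMf hc.le (htime k hk.le).1 hδ0.le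
        (hVval k hk.le) (ι := Sh) (xh := fun i => i) (x₀ := x) (H := fun i => quadHam P c i x)
        (B := B + G * δ ^ 2 - lipElement a j x) (fun i => hq i i.2 x hx) hgl
        (fun i v hv => le_quadHam h1 h2 hx _ hv) (fun i => by linarith [hB i, hK1 j i x hx])
      rw [← hsucc, hVval (k + 1) hk x hx, EReal.coe_le_coe_iff] at h
      linarith)
    (by
      intro k hk lam e hgl j B hB i
      have h : K j i ≤ B + e + stepConst c Lf Mf Lℓ q * δ ^ 2 - lam i := by
        refine hK2 j i _ fun x hx => ?_
        have hv' : quadHam P c i x ≤ (B + e + stepConst c Lf Mf Lℓ q * δ ^ 2 - lam i -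
            lipElement a j x - quadElement c i x) / δ := by
          refine ciSup_le fun v => ?_
          have h := le_value_add_of_forall h1 h2 hfeas hLf hLℓ hMf hc.le (htime k hk.le).1 hδ0.le
            hδT (hVval k hk.le) hx (hq i i.2 x hx) (hgl i) v.2
          rw [← hsucc, hVval (k + 1) hk x hx, EReal.coe_le_coe_iff] at h
          rw [le_div_iff₀ hδ0]
          linarith [hB x hx]
        rw [le_div_iff₀ hδ0] at hv'
        linarith
      have : 0 ≤ G * δ ^ 2 := by positivity
      linarith)
    (fun k hk x hx => exists_quadElement_sub_le hX.isBounded hc hL hD (hVconv k hk)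
      (hVlip k hk) hSh hρh hx)
    (fun k hk x hx => exists_lipElement_le hX.isBounded hL ha (hVlip k hk) hS hρ hx) N le_rfl
  obtain ⟨hle, hge⟩ := herr
  have hstep : 0 ≤ stepConst c Lf Mf Lℓ q := by
    unfold stepConst
    positivity
  set C := (T * (stepConst c Lf Mf Lℓ q + G) + 2 * T * (c * D + 2 * a * n)) * (δ + Δx / δ)
    with hC
  have hρ₁ : 0 ≤ c * D * Δx := by positivity
  have hρ₂ : 0 ≤ 2 * a * n * Δx := by positivity
  -- The extra `ρ` is absorbed by `N + 1 ≤ 2 N`; then `N = T / δ` turns `δ²` into `T δ` and `Δx`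
  -- into `T Δx / δ`.
  have hbound : ∀ ρ, 0 ≤ ρ → ρ ≤ (c * D + 2 * a * n) * Δx →
      N * ((stepConst c Lf Mf Lℓ q + G) * δ ^ 2 + ρ) + ρ ≤ C := by
    intro ρ hρ0 hρ1
    have e1 : N * ρ + ρ ≤ 2 * N * ρ := by
      have : (1 : ℝ) ≤ N := Nat.one_le_cast.2 hN
      nlinarith
    have e2 : 2 * N * ρ ≤ 2 * N * ((c * D + 2 * a * n) * Δx) :=
      mul_le_mul_of_nonneg_left hρ1 (by positivity)
    have e3 : 2 * N * ((c * D + 2 * a * n) * Δx) = 2 * T * (c * D + 2 * a * n) * (Δx / δ) := by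
      rw [← hNδ]
      field_simp
    have e4 : N * ((stepConst c Lf Mf Lℓ q + G) * δ ^ 2) =
        T * (stepConst c Lf Mf Lℓ q + G) * δ := by
      rw [← hNδ]
      ring
    have e5 : 0 ≤ T * (stepConst c Lf Mf Lℓ q + G) * (Δx / δ) := by positivity
    have e6 : 0 ≤ 2 * T * (c * D + 2 * a * n) * δ := by positivity
    rw [hC]
    linarith
  refine iSup_le fun x => ?_
  have hVN := hVval N le_rfl x x.2
  rw [hNδ] at hVN
  let W : P.X → Sh → ℝ := fun x i => quadElement c (i : E n) (x : E n)
  set M : S → Sh → ℝ := fun j i => lipElement a j (xs j i) + quadElement c i (xs j i)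
  have happ : approxValue P c a S Sh K' N x =
      ((⨆ i : Sh, (W x i + realCoeff M K lam₀ N i) : ℝ) : EReal) := by
    have hW : matW P c Sh = fun (x : P.X) (i : Sh) => (W x i : EReal) := rfl
    rw [approxValue, hcoeff, hW]
    exact mulVec_coe W _ x
  beta_reduce
  rw [happ, hVN, ← EReal.coe_sub, EReal.abs_def]
  refine ENNReal.ofReal_le_ofReal (abs_le.2 ⟨?_, ?_⟩)
  · obtain ⟨i, hi⟩ := hge x x.2
    have e := le_ciSup (f := fun i : Sh => W x i + realCoeff M K lam₀ N i)
      (Set.finite_range _).bddAbove i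
    have := hbound (c * D * Δx) hρ₁ (by linarith)
    dsimp only [W] at e
    linarith
  · rw [sub_le_iff_le_add]
    refine ciSup_le fun i => ?_
    have := hbound (2 * a * n * Δx) hρ₂ (by linarith)
    linarith [hle i x x.2]

end MFEM

theorem mainTheorem1 (n : ℕ) (T c L a R D Lf Mf Lℓ Mℓ : ℝ)
    (hT : 0 < T) (hc : 0 < c) (hL : 0 < L) (ha : L ≤ a) (hR : 0 ≤ R)
    (hLf : 0 < Lf) (hMf : 0 < Mf) (hLℓ : 0 < Lℓ) (hMℓ : 0 < Mℓ) :
    ∃ C₁ : ℝ, 0 < C₁ ∧ ∃ C₂ : ℝ, 0 < C₂ ∧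
      ∀ (m : ℕ) (P : MFEM.ControlProblem n m),
        IsCompact P.X → Convex ℝ P.X → (interior P.X).Nonempty → Metric.diam P.X ≤ D →
        MFEM.H1 P Lf Mf → MFEM.H2 P Lℓ Mℓ → MFEM.ConstantControlsFeasible P T →
        (∀ t ∈ Set.Icc (0 : ℝ) T, MFEM.SemiconvexLipschitzOn P.X c L (MFEM.value P t)) →
        ∀ (S Sh : Finset (MFEM.E n)), S.Nonempty → Sh.Nonempty →
          (Sh : Set (MFEM.E n)) ⊆ P.X + Metric.closedBall 0 R →
        ∀ (N : ℕ), 0 < N → ∀ (δ Δx : ℝ), δ = T / N →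
          Δx = max (MFEM.voronoiRadius P.X S)
            (MFEM.voronoiRadius (P.X + Metric.closedBall 0 (L / c)) Sh) →
          MFEM.supNorm (fun x : P.X =>
              MFEM.approxValue P c a S Sh (MFEM.matKH P c a δ S Sh) N x - MFEM.value P T x)
            ≤ ENNReal.ofReal (C₁ * (δ + Δx / δ)) ∧
          MFEM.supNorm (fun x : P.X =>
              MFEM.approxValue P c a S Sh (MFEM.matKHt P c a δ S Sh) N x - MFEM.value P T x)
            ≤ ENNReal.ofReal (C₂ * (Real.sqrt δ + Δx / δ)) := by
  have ha0 : 0 < a := hL.trans_le ha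
  -- `q` bounds the gradients of the elements on `X`, whose centres are within `R` of `X`.
  set q := c * (|D| + R) with hqdef
  have hq0 : 0 ≤ q := by positivity
  set G := (Lℓ + q * Lf + c * Mf) ^ 2 / c with hGdef
  have hG : 0 < G := by positivity
  have hA : 0 < MFEM.stepConst c Lf Mf Lℓ q := by
    unfold MFEM.stepConst
    positivity
  set C : ℝ := T * (MFEM.stepConst c Lf Mf Lℓ q + G) + 2 * T * (c * |D| + 2 * a * n) with hCdef
  have hC : 0 < C := by positivity
  refine ⟨C, hC, C * (1 + Real.sqrt T), by positivity, ?_⟩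
  intro m P hX hXc hXi hDX h1 h2 hfeas hv S Sh hS hSh hShX N hN δ Δx hδ hΔ
  have hXne : P.X.Nonempty := hXi.mono interior_subset
  have hDX' : Metric.diam P.X ≤ |D| := hDX.trans (le_abs_self D)
  have hNR : (0 : ℝ) < N := Nat.cast_pos.2 hN
  have hδ0 : 0 < δ := hδ ▸ div_pos hT hNR
  have hδT : δ ≤ T := hδ ▸ div_le_self hT.le (Nat.one_le_cast.2 hN)
  have hρ : MFEM.voronoiRadius P.X S ≤ Δx := hΔ ▸ le_max_left _ _
  have hρh : MFEM.voronoiRadius (P.X + Metric.closedBall 0 (L / c)) Sh ≤ Δx :=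
    hΔ ▸ le_max_right _ _
  have hΔ0 : 0 ≤ Δx := (MFEM.voronoiRadius_nonneg _ _).trans hρ
  -- Finiteness of the value at time `0` provides a trajectory on `[0, 0]`, whose control at `0`
  -- lies in `U`.
  have hU : P.U.Nonempty := by
    obtain ⟨x, hx⟩ := hXne
    obtain ⟨g, hg, -⟩ := hv 0 ⟨le_rfl, hT.le⟩
    obtain ⟨y, u, hyu⟩ := MFEM.exists_admissible (P := P) (t := 0) (x₀ := x)
      (by rw [hg x hx]; exact EReal.coe_ne_bot _)
    exact ⟨u 0, hyu.1.control_mem 0 ⟨le_rfl, le_rfl⟩⟩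
  have hq : ∀ i ∈ Sh, ∀ x ∈ P.X, ‖-c • (x - i)‖ ≤ q := by
    intro i hi x hx
    obtain ⟨y, hy, b, hb, hyb⟩ := hShX hi
    rw [norm_smul, norm_neg, Real.norm_of_nonneg hc.le, hqdef]
    refine mul_le_mul_of_nonneg_left ?_ hc.le
    have e : x - i = (x - y) - b := by rw [← hyb]; exact sub_add_eq_sub_sub x y b
    rw [e]
    refine (norm_sub_le _ _).trans (add_le_add ?_ (by simpa using hb))
    rw [← dist_eq_norm]
    exact (Metric.dist_le_diam_of_mem hX.isBounded hx hy).trans hDX'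
  constructor
  · choose K hK hK1 hK2 using
      MFEM.matKH_eq_coe (a := a) (S := S) hX hXne hU h1 h2 hδ0.le hq
    exact MFEM.supNorm_approxValue_sub_le hT hc hL.le ha hLf.le hMf.le hLℓ.le hq0 hG.le hX hXne
      hDX' h1 h2 hfeas hU hv hS hSh hq hN hδ hρ hρh hK
      (fun (j : S) (i : Sh) x hx => (hK1 j i x hx).trans (le_add_of_nonneg_right (by positivity))) hK2
  · choose K hK hK1 hK2 using
      MFEM.matKHt_eq_coe (S := S) hX hXc hXne hU h1 h2 hc ha0.le hδ0.le hq
    refine (MFEM.supNorm_approxValue_sub_le hT hc hL.le ha hLf.le hMf.le hLℓ.le hq0 hG.le hX hXne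
      hDX' h1 h2 hfeas hU hv hS hSh hq hN hδ hρ hρh hK hK1 hK2).trans
      (ENNReal.ofReal_le_ofReal ?_)
    rw [← hCdef, mul_assoc]
    refine mul_le_mul_of_nonneg_left ?_ hC.le
    -- Only here is the order `δ` weakened to `√δ`, which accounts for the factor `1 + √T` in the
    -- second constant.
    have e1 : δ ≤ Real.sqrt T * Real.sqrt δ := by
      calc δ = Real.sqrt δ * Real.sqrt δ := (Real.mul_self_sqrt hδ0.le).symm
        _ ≤ Real.sqrt T * Real.sqrt δ := by gcongr
    have e2 : 0 ≤ Real.sqrt T * (Δx / δ) := by positivity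
    linarith [Real.sqrt_nonneg δ]
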